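/- Let $X$ be a real normed space and let $X^*$ be its topological dual. An equivalent dual norm on $X^*$ is a norm on $X^*$, equivalent to the usual one, of the form $\|f\|=\sup\{|f(x)| : x\in X,\ |x|\le 1\}$ for some equivalent norm $|\cdot|$ on $X$. The following two conditions are equivalent: (1) there is an equivalent dual norm $\|\cdot\|$ on $X^*$ that is $w^*$-LUR, that is, whenever $f\in X^*$ and $(f_n)_{n\in\mathbb N}$ is a sequence in $X^*$ with $2\|f\|^2+2\|f_n\|^2-\|f+f_n\|^2\to 0$, the sequence $(f_n)$ converges to $f$ in the weak$^*$ topology $\sigma(X^*,X)$; (2) there is an equivalent dual norm $\|\cdot\|_M$ on $X^*$ whose unit sphere $S_M=\{f\in X^* : \|f\|_M=1\}$ is semimetrizable in the weak$^*$ topology, that is, there is a function $\rho:S_M\times S_M\to[0,\infty)$ with $\rho(f,g)=\rho(g,f)$ for all $f,g$, and with $\rho(f,g)=0$ if and only if $f=g$, such that for every $f\in S_M$ the sets $\{g\in S_M : \rho(f,g)<\varepsilon\}$, $\varepsilon>0$, form a neighbourhood base at $f$ for the weak$^*$ topology restricted to $S_M$. -/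

import Mathlib

open Filter Topology

/-- A function `ρ` on `S × S` is a *symmetric* if it is nonnegative, symmetric in its two arguments,
and vanishes exactly on the diagonal (no triangle inequality is required). -/
structure IsSymmetricDist {S : Type*} (ρ : S → S → ℝ) : Prop where
  nonneg : ∀ x y, 0 ≤ ρ x y
  symm : ∀ x y, ρ x y = ρ y x
  eq_zero_iff : ∀ x y, ρ x y = 0 ↔ x = y

/-- A topological space is *semimetrizable* if it carries a symmetric `ρ` such that at every point
`x` the balls `{y | ρ x y < ε}`, `ε > 0`, form a neighbourhood base (the balls need not be open). -/
def IsSemimetrizable (S : Type*) [TopologicalSpace S] : Prop :=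
  ∃ ρ : S → S → ℝ, IsSymmetricDist ρ ∧
    ∀ x : S, (𝓝 x).HasBasis (fun ε : ℝ => 0 < ε) (fun ε => {y | ρ x y < ε})

/-- `p` is a norm on the normed space `E` that is equivalent to the original norm. -/
def IsEquivalentNorm {E : Type*} [NormedAddCommGroup E] [NormedSpace ℝ E]
    (p : Seminorm ℝ E) : Prop :=
  ∃ c C : ℝ, 0 < c ∧ 0 < C ∧ ∀ x : E, c * ‖x‖ ≤ p x ∧ p x ≤ C * ‖x‖

/-- `q` is an equivalent norm on the dual `X*` which is the dual norm of some equivalent norm `p`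
on `X`, that is, `q f = sup {|f x| : p x ≤ 1}` for every `f`. -/
def IsEquivalentDualNorm {X : Type*} [NormedAddCommGroup X] [NormedSpace ℝ X]
    (q : Seminorm ℝ (StrongDual ℝ X)) : Prop :=
  IsEquivalentNorm q ∧
    ∃ p : Seminorm ℝ X, IsEquivalentNorm p ∧
      ∀ f : StrongDual ℝ X, IsLUB {r : ℝ | ∃ x : X, p x ≤ 1 ∧ r = |f x|} (q f)

/-- The norm `q` on `X*` is weak*-locally uniformly rotund. -/
def IsWeakStarLUR {X : Type*} [NormedAddCommGroup X] [NormedSpace ℝ X]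
    (q : Seminorm ℝ (StrongDual ℝ X)) : Prop :=
  ∀ (f : StrongDual ℝ X) (u : ℕ → StrongDual ℝ X),
    Tendsto (fun n => 2 * q f ^ 2 + 2 * q (u n) ^ 2 - q (f + u n) ^ 2) atTop (𝓝 0) →
      Tendsto (fun n => StrongDual.toWeakDual (u n)) atTop (𝓝 (StrongDual.toWeakDual f))

/-- The unit sphere of the norm `q` on `X*`, as a subset of `X*` with its weak* topology. -/
def weakStarUnitSphere {X : Type*} [NormedAddCommGroup X] [NormedSpace ℝ X]
    (q : Seminorm ℝ (StrongDual ℝ X)) : Set (WeakDual ℝ X) :=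
  {f | q (WeakDual.toStrongDual f) = 1}

/-! If the norm `q` is w*-LUR, then `4 - q (f + g) ^ 2` is a semimetric on its sphere: rotundity
puts small balls inside neighbourhoods, and weak* lower semicontinuity of `q` makes every ball a
neighbourhood.

For the converse, cover the sphere at scale `1/(m+1)` by open sets that are small for `ρ`.
Well-ordering the cover and using symmetry of `ρ` yields countably many refinements, one of which
has each given point in a single member (`IsSymmetricDist.exists_refinements`). For each refinement,
repeatedly strip from the dual ball all slices lying in a member. Every sphere point disappears
after finitely many steps (`IsEquivalentDualNorm.exists_slice_iterate`): otherwise the weak* compact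
convex remainder would have an extreme point of norm one, and Choquet's lemma would cut off one more
slice there.

Only countably many convex sets arise. Their slices and the half-spaces missing them, dilated by
rationals, are encoded in one dual norm (`exists_dualNorm_of_families`) in the style of Deville's
slice-localization arguments. Rotundity at `f` then forces the sequence towards slices containing
the normalized `f` (`eventually_exists_slice`). The slice lies in the unique member containing that
point, so every cluster point of the normalized sequence is in the same `ρ`-small sets as `f` and
must agree with it. -/

/-! ### Weak* separation, slices and extreme points. -/

section WeakDualConvexity

variable {X : Type*} [NormedAddCommGroup X] [NormedSpace ℝ X]

theorem WeakDual.locallyConvexSpace_real : LocallyConvexSpace ℝ (WeakDual ℝ X) :=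
  inferInstanceAs (LocallyConvexSpace ℝ (WeakBilin (topDualPairing ℝ X)))

/-- Hahn–Banach separation in the weak* topology: separating functionals are evaluations. -/
theorem WeakDual.exists_eval_separation {C : Set (WeakDual ℝ X)} (hconv : Convex ℝ C)
    (hcl : IsClosed C) {f : WeakDual ℝ X} (hf : f ∉ C) :
    ∃ (h : X) (u : ℝ), (∀ g ∈ C, g h < u) ∧ u < f h := by
  have := WeakDual.locallyConvexSpace_real (X := X)
  obtain ⟨φ, u, h1, h2⟩ := geometric_hahn_banach_closed_point hconv hcl hf
  obtain ⟨h, hh⟩ := LinearMap.dualEmbedding_surjective (topDualPairing ℝ X) φ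
  have hφ : ∀ g : WeakDual ℝ X, φ g = g h := fun g => by rw [← hh]; rfl
  exact ⟨h, u, fun g hg => by rw [← hφ]; exact h1 g hg, by rw [← hφ]; exact h2⟩

theorem WeakDual.combo_apply (a b : ℝ) (f g : WeakDual ℝ X) (x : X) :
    (a • f + b • g) x = a * f x + b * g x := rfl

theorem WeakDual.convex_eval_le (h : X) (u : ℝ) : Convex ℝ {g : WeakDual ℝ X | g h ≤ u} := by
  intro f hf g hg a b ha hb hab
  simp only [Set.mem_ofPred_eq, WeakDual.combo_apply] at *
  calc a * f h + b * g h ≤ a * u + b * u := by gcongr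
    _ = u := by rw [← add_mul, hab, one_mul]

theorem IsCompact.convexJoin_real {E : Type*} [AddCommGroup E] [Module ℝ E] [TopologicalSpace E]
    [ContinuousAdd E] [ContinuousSMul ℝ E] {s t : Set E} (hs : IsCompact s) (ht : IsCompact t) :
    IsCompact (convexJoin ℝ s t) := by
  have : convexJoin ℝ s t =
      (fun z : ℝ × E × E => (1 - z.1) • z.2.1 + z.1 • z.2.2) '' (Set.Icc 0 1 ×ˢ s ×ˢ t) := by
    ext x
    simp only [mem_convexJoin, segment_eq_image, Set.mem_image, Set.mem_prod, Prod.exists]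
    constructor
    · rintro ⟨a, ha, b, hb, θ, hθ, rfl⟩
      exact ⟨θ, a, b, ⟨hθ, ha, hb⟩, rfl⟩
    · rintro ⟨θ, a, b, ⟨hθ, ha, hb⟩, rfl⟩
      exact ⟨a, ha, b, hb, θ, hθ, rfl⟩
  rw [this]
  exact (isCompact_Icc.prod (hs.prod ht)).image (by fun_prop)

/-- Choquet's lemma: slices form a neighbourhood base at an extreme point of a weak* compact
convex set. -/
theorem WeakDual.exists_slice_of_mem_extremePoints {C U : Set (WeakDual ℝ X)} (hC : IsCompact C)
    (hconv : Convex ℝ C) {e : WeakDual ℝ X} (he : e ∈ C.extremePoints ℝ) (hU : IsOpen U)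
    (heU : e ∈ U) : ∃ (h : X) (u : ℝ), u < e h ∧ ∀ g ∈ C, u ≤ g h → g ∈ U := by
  -- By compactness `C \ U` is covered by finitely many convex compact pieces of `C` missing `e`.
  -- Extremality keeps `e` out of their joins, so one separation suffices.
  have key : ∃ K, IsCompact K ∧ Convex ℝ K ∧ K ⊆ C ∧ e ∉ K ∧ C \ U ⊆ K := by
    refine IsCompact.induction_on (p := fun t => ∃ K, IsCompact K ∧ Convex ℝ K ∧ K ⊆ C ∧ e ∉ K ∧
      t ⊆ K) (hC.diff hU) ⟨∅, by simp [convex_empty]⟩ ?_ ?_ ?_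
    · rintro s t hst ⟨K, h1, h2, h3, h4, h5⟩
      exact ⟨K, h1, h2, h3, h4, hst.trans h5⟩
    · rintro s t ⟨K, h1, h2, h3, h4, h5⟩ ⟨L, k1, k2, k3, k4, k5⟩
      rcases K.eq_empty_or_nonempty with rfl | hKn
      · exact ⟨L, k1, k2, k3, k4, Set.union_subset (h5.trans (Set.empty_subset _)) k5⟩
      rcases L.eq_empty_or_nonempty with rfl | hLn
      · exact ⟨K, h1, h2, h3, h4, Set.union_subset h5 (k5.trans (Set.empty_subset _))⟩
      refine ⟨convexJoin ℝ K L, h1.convexJoin_real k1, h2.convexJoin k2, ?_, ?_, ?_⟩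
      · exact convexJoin_subset h3 k3 hconv
      · intro hmem
        obtain ⟨a, ha, b, hb, hab⟩ := mem_convexJoin.1 hmem
        rcases (mem_extremePoints_iff_forall_segment.1 he).2 a (h3 ha) b (k3 hb) hab with rfl | rfl
        · exact h4 ha
        · exact k4 hb
      · exact Set.union_subset (h5.trans (subset_convexJoin_left hLn))
          (k5.trans (subset_convexJoin_right hKn))
    · rintro x ⟨hxC, hxU⟩
      have hne : e ∉ ({x} : Set (WeakDual ℝ X)) := by
        rintro rfl; exact hxU heU
      obtain ⟨h, u, hx, heu⟩ :=
        WeakDual.exists_eval_separation (convex_singleton x) isClosed_singleton hne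
      have hx := hx x rfl
      refine ⟨(C \ U) ∩ {g | g h < u}, inter_mem self_mem_nhdsWithin (mem_nhdsWithin_of_mem_nhds
        ((isOpen_lt (WeakDual.eval_continuous h) continuous_const).mem_nhds hx)),
        C ∩ {g | g h ≤ u}, hC.inter_right
          (isClosed_le (WeakDual.eval_continuous h) continuous_const),
        hconv.inter (WeakDual.convex_eval_le h u), Set.inter_subset_left,
        fun h' => absurd h'.2 (not_le.2 heu), fun g hg => ⟨hg.1.1, show g h ≤ u from le_of_lt hg.2⟩⟩
  obtain ⟨K, h1, h2, h3, h4, h5⟩ := key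
  obtain ⟨h, u, hK, heu⟩ := WeakDual.exists_eval_separation h2 h1.isClosed h4
  refine ⟨h, u, heu, fun g hg hgu => ?_⟩
  by_contra hgU
  exact absurd (hK g (h5 ⟨hg, hgU⟩)) (not_lt.2 hgu)

/-- If a sequence of evaluations bounded by `1` on a weak* compact set `C` tends to `1` fast enough
at one point of `C`, then it tends to `1` at some extreme point of `C`. -/
theorem WeakDual.exists_extremePoint_tendsto_one {C : Set (WeakDual ℝ X)} (hC : IsCompact C)
    (z : ℕ → X) (hz : ∀ g ∈ C, ∀ j, g (z j) ≤ 1) {f : WeakDual ℝ X} (hf : f ∈ C)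
    (hfz : ∀ j, 1 - (1 / 2 : ℝ) ^ j ≤ f (z j)) :
    ∃ e ∈ C.extremePoints ℝ, Tendsto (fun j => e (z j)) atTop (𝓝 1) := by
  -- On `C` this total deficit is lower semicontinuous and affine, and it is finite at `f` by
  -- comparison with a geometric series. Its minimizers form a closed face, whose extreme points are
  -- extreme in `C` and have deficits tending to zero.
  set D : WeakDual ℝ X → ENNReal := fun g => ∑' j, ENNReal.ofReal (1 - g (z j)) with hD
  have hlsc : LowerSemicontinuous D := lowerSemicontinuous_tsum fun j =>
    (ENNReal.continuous_ofReal.comp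
      (continuous_const.sub (WeakDual.eval_continuous (z j)))).lowerSemicontinuous
  obtain ⟨m, hm, hmin⟩ := (hlsc.lowerSemicontinuousOn C).exists_isMinOn ⟨f, hf⟩ hC
  have hDf : D f ≠ ⊤ := by
    have hsum : Summable fun j : ℕ => (1 / 2 : ℝ) ^ j := summable_geometric_two
    refine ne_top_of_le_ne_top hsum.tsum_ofReal_ne_top
      (ENNReal.tsum_le_tsum fun j => ENNReal.ofReal_le_ofReal (by linarith [hfz j]))
  have hDm : D m ≠ ⊤ := ne_top_of_le_ne_top hDf (hmin hf)
  set F : Set (WeakDual ℝ X) := C ∩ {g | D g ≤ D m} with hF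
  have hFc : IsCompact F := hC.inter_right (hlsc.isClosed_preimage _)
  have hFext : IsExtreme ℝ C F := by
    refine ⟨Set.inter_subset_left, ?_⟩
    rintro g₁ hg₁ g₂ hg₂ g ⟨hg, hgm⟩ ⟨a, b, ha, hb, hab, rfl⟩
    refine ⟨hg₁, ?_⟩
    have hsplit : D (a • g₁ + b • g₂) = ENNReal.ofReal a * D g₁ + ENNReal.ofReal b * D g₂ := by
      simp only [hD]
      rw [← ENNReal.tsum_mul_left, ← ENNReal.tsum_mul_left, ← ENNReal.tsum_add]
      congr 1
      ext j : 1
      rw [← ENNReal.ofReal_mul ha.le, ← ENNReal.ofReal_mul hb.le, ← ENNReal.ofReal_add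
        (mul_nonneg ha.le (by linarith [hz _ hg₁ j])) (mul_nonneg hb.le (by linarith [hz _ hg₂ j])),
        WeakDual.combo_apply]
      congr 1
      linear_combination (-1) * hab
    have h2 : D m ≤ D g₂ := hmin hg₂
    have hgm' : ENNReal.ofReal a * D g₁ + ENNReal.ofReal b * D g₂ ≤ D m := hsplit ▸ hgm
    have hDmsplit : D m = ENNReal.ofReal a * D m + ENNReal.ofReal b * D m := by
      rw [← add_mul, ← ENNReal.ofReal_add ha.le hb.le, hab, ENNReal.ofReal_one, one_mul]
    -- Minimality allows `D g₂` to be replaced by `D m`, and finiteness of `D m` allows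
    -- cancellation.
    have hle : ENNReal.ofReal a * D g₁ + ENNReal.ofReal b * D m ≤
        ENNReal.ofReal a * D m + ENNReal.ofReal b * D m := by
      rw [← hDmsplit]
      exact le_trans (by gcongr) hgm'
    have hle' := (ENNReal.add_le_add_iff_right
      (ENNReal.mul_ne_top ENNReal.ofReal_ne_top hDm)).1 hle
    exact (ENNReal.mul_le_mul_iff_right (by simpa using ha) ENNReal.ofReal_ne_top).1 hle'
  have := WeakDual.locallyConvexSpace_real (X := X)
  obtain ⟨e, he⟩ := hFc.extremePoints_nonempty ⟨m, hm, le_refl (D m)⟩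
  refine ⟨e, hFext.extremePoints_subset_extremePoints he, ?_⟩
  have heF : e ∈ F := extremePoints_subset he
  have hDe : D e ≠ ⊤ := ne_top_of_le_ne_top hDm heF.2
  have ht := ENNReal.tendsto_atTop_zero_of_tsum_ne_top hDe
  have ht' := (ENNReal.tendsto_toReal ENNReal.zero_ne_top).comp ht
  have ht'' : Tendsto (fun j => 1 - e (z j)) atTop (𝓝 0) := by
    refine ht'.congr fun j => ?_
    simp only [Function.comp]
    rw [ENNReal.toReal_ofReal (by linarith [hz e heF.1 j])]
  simpa using (tendsto_const_nhds (x := (1 : ℝ))).sub ht''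

end WeakDualConvexity

/-! ### Dual norms and the semimetric of a w*-LUR norm. -/

section DualNorms

variable {X : Type*} [NormedAddCommGroup X] [NormedSpace ℝ X] {q : Seminorm ℝ (StrongDual ℝ X)}

theorem IsEquivalentDualNorm.isClosed_sublevel (hq : IsEquivalentDualNorm q) (c : ℝ) :
    IsClosed {f : WeakDual ℝ X | q (WeakDual.toStrongDual f) ≤ c} := by
  obtain ⟨-, p, -, hp⟩ := hq
  have : {f : WeakDual ℝ X | q (WeakDual.toStrongDual f) ≤ c} =
      ⋂ x ∈ {x : X | p x ≤ 1}, {f : WeakDual ℝ X | |f x| ≤ c} := by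
    ext f
    simp only [Set.mem_ofPred_eq, isLUB_le_iff (hp _), mem_upperBounds, Set.mem_iInter]
    constructor
    · intro h x hx
      exact h _ ⟨x, hx, rfl⟩
    · rintro h _ ⟨x, hx, rfl⟩
      exact h x hx
  rw [this]
  exact isClosed_biInter fun x _ =>
    isClosed_le (WeakDual.eval_continuous x).abs continuous_const

theorem IsEquivalentDualNorm.isCompact_sublevel (hq : IsEquivalentDualNorm q) (c : ℝ) :
    IsCompact {f : WeakDual ℝ X | q (WeakDual.toStrongDual f) ≤ c} := by
  obtain ⟨a, A, ha, -, h⟩ := hq.1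
  refine (WeakDual.isCompact_closedBall (𝕜 := ℝ) (0 : StrongDual ℝ X) (c / a)).of_isClosed_subset
    (hq.isClosed_sublevel c) fun f hf => ?_
  simp only [Set.mem_preimage, mem_closedBall_zero_iff]
  rw [le_div_iff₀ ha]
  linarith [(h (WeakDual.toStrongDual f)).1, show q (WeakDual.toStrongDual f) ≤ c from hf]

theorem Seminorm.convex_sublevel_toStrongDual (q : Seminorm ℝ (StrongDual ℝ X)) (c : ℝ) :
    Convex ℝ {f : WeakDual ℝ X | q (WeakDual.toStrongDual f) ≤ c} := by
  intro f hf g hg a b ha hb hab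
  simp only [Set.mem_ofPred_eq, map_add, map_smul] at *
  calc _ ≤ a * q (WeakDual.toStrongDual f) + b * q (WeakDual.toStrongDual g) := by
        refine (map_add_le_add q _ _).trans (le_of_eq ?_)
        rw [map_smul_eq_mul, map_smul_eq_mul, Real.norm_of_nonneg ha, Real.norm_of_nonneg hb]
    _ ≤ a * c + b * c := by gcongr
    _ = c := by rw [← add_mul, hab, one_mul]

theorem IsEquivalentNorm.eq_zero_of_map_eq_zero {E : Type*} [NormedAddCommGroup E]
    [NormedSpace ℝ E] {p : Seminorm ℝ E} (hp : IsEquivalentNorm p) {x : E} (hx : p x = 0) :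
    x = 0 := by
  obtain ⟨c, C, hc, -, h⟩ := hp
  have := (h x).1
  rw [hx] at this
  exact norm_le_zero_iff.1 (by nlinarith)

/-- The predual norm of a norm on the dual. -/
noncomputable def predualSeminorm (q : Seminorm ℝ (StrongDual ℝ X)) (c : ℝ)
    (hc : ∀ g : StrongDual ℝ X, q g ≤ 1 → ‖g‖ ≤ c) : Seminorm ℝ X :=
  have hbdd : ∀ x : X, BddAbove (Set.range fun g : {g : StrongDual ℝ X // q g ≤ 1} => |g.1 x|) := by
    intro x
    refine ⟨c * ‖x‖, ?_⟩
    rintro _ ⟨g, rfl⟩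
    exact (g.1.le_opNorm x).trans (by gcongr; exact hc g.1 g.2)
  have : Nonempty {g : StrongDual ℝ X // q g ≤ 1} := ⟨⟨0, by simp⟩⟩
  Seminorm.of (fun x => ⨆ g : {g : StrongDual ℝ X // q g ≤ 1}, |g.1 x|)
    (fun x y => ciSup_le fun g => by
      rw [map_add]
      exact (abs_add_le _ _).trans (add_le_add (le_ciSup (hbdd x) g) (le_ciSup (hbdd y) g)))
    (fun a x => by
      rw [Real.mul_iSup_of_nonneg (norm_nonneg a)]
      simp [abs_mul])

theorem predualSeminorm_le_iff {c : ℝ} {hc : ∀ g : StrongDual ℝ X, q g ≤ 1 → ‖g‖ ≤ c} {x : X}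
    {b : ℝ} : predualSeminorm q c hc x ≤ b ↔ ∀ g, q g ≤ 1 → |g x| ≤ b := by
  have hbdd : BddAbove (Set.range fun g : {g : StrongDual ℝ X // q g ≤ 1} => |g.1 x|) := by
    refine ⟨c * ‖x‖, ?_⟩
    rintro _ ⟨g, rfl⟩
    exact (g.1.le_opNorm x).trans (by gcongr; exact hc g.1 g.2)
  have : Nonempty {g : StrongDual ℝ X // q g ≤ 1} := ⟨⟨0, by simp⟩⟩
  change (⨆ g : {g : StrongDual ℝ X // q g ≤ 1}, |g.1 x|) ≤ b ↔ _
  rw [ciSup_le_iff hbdd]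
  simp

/-- An equivalent norm on the dual with weak* closed unit ball is a dual norm. -/
theorem IsEquivalentNorm.isEquivalentDualNorm (hq : IsEquivalentNorm q)
    (hcl : IsClosed {f : WeakDual ℝ X | q (WeakDual.toStrongDual f) ≤ 1}) :
    IsEquivalentDualNorm q := by
  refine ⟨hq, ?_⟩
  obtain ⟨a, A, ha, hA, h⟩ := id hq
  have hc : ∀ g : StrongDual ℝ X, q g ≤ 1 → ‖g‖ ≤ 1 / a := fun g hg => by
    rw [le_div_iff₀ ha]; linarith [(h g).1]
  set p := predualSeminorm q (1 / a) hc with hp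
  have hpe : IsEquivalentNorm p := by
    refine ⟨1 / A, 1 / a, by positivity, by positivity, fun x => ⟨?_, ?_⟩⟩
    · obtain ⟨g, hg1, hgx⟩ := exists_dual_vector'' ℝ x
      have hgA : q ((1 / A) • g) ≤ 1 := by
        rw [map_smul_eq_mul, Real.norm_of_nonneg (by positivity)]
        have := (h g).2
        rw [div_mul_eq_mul_div, one_mul, div_le_one hA]
        nlinarith
      have := predualSeminorm_le_iff.1 (le_refl (p x)) _ hgA
      refine le_trans (le_of_eq ?_) this
      simp only [_root_.smul_apply, hgx, smul_eq_mul]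
      rw [abs_of_nonneg (by simp; positivity)]
      simp
    · refine predualSeminorm_le_iff.2 fun g hg => (g.le_opNorm x).trans ?_
      gcongr
      exact hc g hg
  refine ⟨p, hpe, fun f => ⟨?_, fun b hb => ?_⟩⟩
  · rintro _ ⟨x, hx, rfl⟩
    rcases (apply_nonneg q f).eq_or_lt with h0 | h0
    · rw [← h0, hq.eq_zero_of_map_eq_zero h0.symm]; simp
    · have h1 : q ((q f)⁻¹ • f) ≤ 1 := by
        rw [map_smul_eq_mul, Real.norm_of_nonneg (by positivity), inv_mul_cancel₀ h0.ne']
      have := predualSeminorm_le_iff.1 hx _ h1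
      rw [_root_.smul_apply, smul_eq_mul, abs_mul, abs_of_pos (by positivity),
        inv_mul_le_iff₀ h0, mul_one] at this
      exact this
  · by_contra! hlt
    have hb0 : 0 ≤ b := by simpa using hb ⟨0, by simp, rfl⟩
    -- Since `t < q f`, the point `t⁻¹ • f` lies outside the dual ball. A separating vector scaled
    -- by `u⁻¹` lies in the `p`-ball and gives `f` a value above `t > b`.
    obtain ⟨t, hbt, htf⟩ := exists_between hlt
    have ht : 0 < t := hb0.trans_lt hbt
    have hnot : StrongDual.toWeakDual (t⁻¹ • f) ∉
        {f : WeakDual ℝ X | q (WeakDual.toStrongDual f) ≤ 1} := by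
      simp only [Set.mem_ofPred_eq, StrongDual.toStrongDual_toWeakDual, not_le]
      rw [map_smul_eq_mul, Real.norm_of_nonneg (by positivity), lt_inv_mul_iff₀ ht, mul_one]
      exact htf
    obtain ⟨x, u, hu, hfu⟩ := WeakDual.exists_eval_separation
      (q.convex_sublevel_toStrongDual 1) hcl hnot
    have hu0 : 0 < u := by
      have := hu 0 (by simp)
      exact this
    have hpx : p (u⁻¹ • x) ≤ 1 := by
      rw [map_smul_eq_mul, Real.norm_of_nonneg (by positivity), inv_mul_le_iff₀ hu0, mul_one]
      refine predualSeminorm_le_iff.2 fun g hg => abs_le.2 ⟨?_, ?_⟩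
      · have := hu (StrongDual.toWeakDual (-g)) (by simpa using hg)
        rw [StrongDual.toWeakDual_apply, _root_.neg_apply] at this
        linarith
      · exact (hu (StrongDual.toWeakDual g) (by simpa using hg)).le
    have h1 := hb ⟨u⁻¹ • x, hpx, rfl⟩
    rw [StrongDual.toWeakDual_apply, _root_.smul_apply, smul_eq_mul,
      lt_inv_mul_iff₀ ht] at hfu
    rw [map_smul, smul_eq_mul] at h1
    have h2 := (le_abs_self _).trans h1
    rw [inv_mul_le_iff₀ hu0] at h2
    nlinarith

/-- On the sphere the rotundity defect is `4 - q (f + g) ^ 2`, which serves as the symmetric.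
Sequences suffice for the inclusion of balls in neighbourhoods because the balls are indexed by
reals. -/
theorem IsWeakStarLUR.isSemimetrizable (hq : IsEquivalentDualNorm q) (hlur : IsWeakStarLUR q) :
    IsSemimetrizable (weakStarUnitSphere q) := by
  have hle : ∀ f g : weakStarUnitSphere q,
      q (WeakDual.toStrongDual f.1 + WeakDual.toStrongDual g.1) ≤ 2 := fun f g => by
    have h1 : q (WeakDual.toStrongDual f.1) = 1 := f.2
    have h2 : q (WeakDual.toStrongDual g.1) = 1 := g.2
    linarith [map_add_le_add q (WeakDual.toStrongDual f.1) (WeakDual.toStrongDual g.1)]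
  have hlim : ∀ (f : weakStarUnitSphere q) (u : ℕ → weakStarUnitSphere q),
      Tendsto (fun n => 4 - q (WeakDual.toStrongDual f.1 + WeakDual.toStrongDual (u n).1) ^ 2)
        atTop (𝓝 0) → Tendsto u atTop (𝓝 f) := fun f u hu => by
    rw [tendsto_subtype_rng]
    refine hlur (WeakDual.toStrongDual f.1) (fun n => WeakDual.toStrongDual (u n).1)
      (hu.congr fun n => ?_)
    have h1 : q (WeakDual.toStrongDual f.1) = 1 := f.2
    have h2 : q (WeakDual.toStrongDual (u n).1) = 1 := (u n).2
    rw [h1, h2]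
    norm_num
  refine ⟨fun f g => 4 - q (WeakDual.toStrongDual f.1 + WeakDual.toStrongDual g.1) ^ 2,
    ⟨fun f g => ?_, fun f g => by rw [add_comm], fun f g => ⟨fun h => ?_, ?_⟩⟩, fun f => ?_⟩
  · nlinarith [hle f g, apply_nonneg q (WeakDual.toStrongDual f.1 + WeakDual.toStrongDual g.1)]
  · have := hlim f (fun _ => g) (by simp only [h]; exact tendsto_const_nhds)
    exact (tendsto_nhds_unique this tendsto_const_nhds)
  · rintro rfl
    have h1 : q (WeakDual.toStrongDual f.1) = 1 := f.2
    rw [← two_smul ℝ, map_smul_eq_mul, h1]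
    norm_num
  · refine ⟨fun t => ⟨fun ht => ?_, ?_⟩⟩
    · by_contra! hcon
      have hn : ∀ n : ℕ, ∃ g : weakStarUnitSphere q,
          4 - q (WeakDual.toStrongDual f.1 + WeakDual.toStrongDual g.1) ^ 2 < 1 / ((n : ℝ) + 1) ∧
            g ∉ t := fun n => by
        obtain ⟨g, hg, hgt⟩ := Set.not_subset.1 (hcon (1 / ((n : ℝ) + 1)) (by positivity))
        exact ⟨g, hg, hgt⟩
      choose u hu hut using hn
      have := hlim f u (squeeze_zero (fun n => by
        nlinarith [hle f (u n),
          apply_nonneg q (WeakDual.toStrongDual f.1 + WeakDual.toStrongDual (u n).1)])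
        (fun n => (hu n).le) tendsto_one_div_add_atTop_nhds_zero_nat)
      obtain ⟨n, hn⟩ := (this.eventually_mem ht).exists
      exact hut n hn
    · rintro ⟨ε, hε, hsub⟩
      refine mem_of_superset ?_ hsub
      -- The threshold works because `(2 - ε/4)² ≥ 4 - ε`; the maximum with `0` covers large `ε`.
      have hcl : IsClosed {g : weakStarUnitSphere q |
          q (WeakDual.toStrongDual (f.1 + g.1)) ≤ max 0 (2 - ε / 4)} :=
        (hq.isClosed_sublevel _).preimage (continuous_const.add continuous_subtype_val)
      have hmem : f ∈ {g : weakStarUnitSphere q |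
          q (WeakDual.toStrongDual (f.1 + g.1)) ≤ max 0 (2 - ε / 4)}ᶜ := by
        have h1 : q (WeakDual.toStrongDual f.1) = 1 := f.2
        simp only [Set.mem_compl_iff, Set.mem_ofPred_eq, not_le]
        rw [← two_smul ℝ, map_smul, map_smul_eq_mul, h1, max_lt_iff]
        norm_num
        linarith
      filter_upwards [hcl.isOpen_compl.mem_nhds hmem] with g hg
      simp only [Set.mem_compl_iff, Set.mem_ofPred_eq, not_le, map_add, max_lt_iff] at hg ⊢
      rcases le_total (2 - ε / 4) 0 with h0 | h0
      · nlinarith [hg.1]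
      · nlinarith [hg.2]

end DualNorms

/-! ### Refinements of open covers of a semimetrizable space. -/

/-- In a semimetrizable subspace `S`, every open cover indexed by `S` has a sequence of open
precise refinements such that each point of `S` lies in exactly one member of some refinement. -/
theorem IsSymmetricDist.exists_refinements {Y : Type*} [TopologicalSpace Y] {S : Set Y}
    {ρ : S → S → ℝ} (hρ : IsSymmetricDist ρ)
    (hbasis : ∀ x : S, (𝓝 x).HasBasis (fun ε : ℝ => 0 < ε) (fun ε => {y | ρ x y < ε}))
    (U : S → Set Y) (hU : ∀ x, IsOpen (U x)) (hmem : ∀ x : S, x.1 ∈ U x) :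
    ∃ V : ℕ → S → Set Y, (∀ n x, IsOpen (V n x)) ∧ (∀ n x, V n x ⊆ U x) ∧
      (∀ n, ∀ f ∈ S, ∃ x, f ∈ V n x) ∧ ∀ f ∈ S, ∃ n x, ∀ x', f ∈ V n x' → x' = x := by
  have hN : ∀ (n : ℕ) (y : S), ∃ O : Set Y, IsOpen O ∧ y.1 ∈ O ∧
      ∀ z : S, z.1 ∈ O → ρ y z < 1 / ((n : ℝ) + 1) := fun n y => by
    have := (hbasis y).mem_of_mem (i := 1 / ((n : ℝ) + 1)) (by positivity)
    rw [nhds_subtype_eq_comap, mem_comap] at this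
    obtain ⟨t, ht, hts⟩ := this
    obtain ⟨O, hOt, hO, hy⟩ := mem_nhds_iff.1 ht
    exact ⟨O, hO, hy, fun z hz => hts (hOt hz)⟩
  choose N hNo hNmem hNρ using hN
  -- A point belongs to `V n x` if it is in `U x` and `N n`-near some `y` lying in no earlier `U z`.
  -- For the least index `x` of `f`, earlier members miss `f`. A later one would give `y ∉ U x` with
  -- `ρ y f` small, whereas by symmetry small `ρ f y` forces `y ∈ U x`.
  let r : S → S → Prop := WellOrderingRel
  have hr : IsWellOrder S r := WellOrderingRel.isWellOrder
  have hleast : ∀ f : S, ∃ x, f.1 ∈ U x ∧ ∀ z, r z x → f.1 ∉ U z := fun f => by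
    obtain ⟨x, hx, hmin⟩ := hr.wf.has_min {x | f.1 ∈ U x} ⟨f, hmem f⟩
    exact ⟨x, hx, fun z hz hfz => hmin z hfz hz⟩
  refine ⟨fun n x => U x ∩ ⋃ y ∈ {y : S | ∀ z, r z x → y.1 ∉ U z}, N n y, fun n x =>
    (hU x).inter (isOpen_biUnion fun y _ => hNo n y), fun n x => Set.inter_subset_left,
    fun n f hf => ?_, fun f hf => ?_⟩
  · obtain ⟨x, hx, hxm⟩ := hleast ⟨f, hf⟩
    exact ⟨x, hx, Set.mem_biUnion (x := (⟨f, hf⟩ : S)) hxm (hNmem n _)⟩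
  · obtain ⟨x, hx, hxm⟩ := hleast ⟨f, hf⟩
    have hnb : {z : S | z.1 ∈ U x} ∈ 𝓝 (⟨f, hf⟩ : S) :=
      ((hU x).preimage continuous_subtype_val).mem_nhds hx
    obtain ⟨ε, hε, hsub⟩ := (hbasis _).mem_iff.1 hnb
    obtain ⟨n, hn⟩ := exists_nat_one_div_lt hε
    refine ⟨n, x, fun x' hx' => ?_⟩
    rcases trichotomous_of r x' x with h | h | h
    · exact absurd hx'.1 (hxm x' h)
    · exact h
    · obtain ⟨y, hy, hfy⟩ := Set.mem_iUnion₂.1 hx'.2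
      have h1 : ρ y ⟨f, hf⟩ < 1 / ((n : ℝ) + 1) := hNρ n y ⟨f, hf⟩ hfy
      rw [hρ.symm] at h1
      exact absurd (hsub (h1.trans hn)) (hy x h)

/-! ### Iterated removal of slices from the dual ball. -/

section SliceDerivative

variable {X : Type*} [NormedAddCommGroup X] [NormedSpace ℝ X] {ι : Type*}

/-- The pairs `(h, u)` whose slice `{g ∈ C | u < g h}` is contained in a member of `V`. -/
def sliceFamily (V : ι → Set (WeakDual ℝ X)) (C : Set (WeakDual ℝ X)) : Set (X × ℝ) :=
  {s | ‖s.1‖ ≤ 1 ∧ 0 ≤ s.2 ∧ ∃ i, ∀ g ∈ C, s.2 < g s.1 → g ∈ V i}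

/-- What remains of `C` after removing all slices contained in a member of `V`. -/
def sliceDerivative (V : ι → Set (WeakDual ℝ X)) (C : Set (WeakDual ℝ X)) :
    Set (WeakDual ℝ X) :=
  {g ∈ C | ∀ s ∈ sliceFamily V C, g s.1 ≤ s.2}

theorem sliceDerivative_eq_inter (V : ι → Set (WeakDual ℝ X)) (C : Set (WeakDual ℝ X)) :
    sliceDerivative V C = C ∩ ⋂ s ∈ sliceFamily V C, {g | g s.1 ≤ s.2} := by
  ext g
  simp [sliceDerivative]

theorem IsCompact.sliceDerivative {C : Set (WeakDual ℝ X)} (hC : IsCompact C)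
    (V : ι → Set (WeakDual ℝ X)) : IsCompact (sliceDerivative V C) := by
  rw [sliceDerivative_eq_inter]
  exact hC.inter_right (isClosed_biInter fun s _ =>
    isClosed_le (WeakDual.eval_continuous _) continuous_const)

theorem Convex.sliceDerivative {C : Set (WeakDual ℝ X)} (hC : Convex ℝ C)
    (V : ι → Set (WeakDual ℝ X)) : Convex ℝ (sliceDerivative V C) := by
  rw [sliceDerivative_eq_inter]
  exact hC.inter (convex_iInter₂ fun s _ => WeakDual.convex_eval_le _ _)

/-- Slice levels are nonnegative, so the origin is never removed. Each remainder is therefore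
star-shaped about `0`, which later permits dilations. -/
theorem iterate_sliceDerivative_spec {C : Set (WeakDual ℝ X)} (hC : IsCompact C)
    (hconv : Convex ℝ C) (h0 : (0 : WeakDual ℝ X) ∈ C) (V : ι → Set (WeakDual ℝ X)) (j : ℕ) :
    IsCompact ((sliceDerivative V)^[j] C) ∧ Convex ℝ ((sliceDerivative V)^[j] C) ∧
      (0 : WeakDual ℝ X) ∈ (sliceDerivative V)^[j] C ∧ (sliceDerivative V)^[j] C ⊆ C := by
  induction j with
  | zero => exact ⟨hC, hconv, h0, subset_rfl⟩
  | succ j ih =>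
    rw [Function.iterate_succ_apply']
    exact ⟨ih.1.sliceDerivative V, ih.2.1.sliceDerivative V, ⟨ih.2.2.1, fun s hs => hs.2.1⟩,
      fun g hg => ih.2.2.2 hg.1⟩

theorem IsEquivalentDualNorm.exists_eval_gt {q : Seminorm ℝ (StrongDual ℝ X)}
    (hq : IsEquivalentDualNorm q) {f : StrongDual ℝ X} {c : ℝ} (hc : c < q f) :
    ∃ x : X, (∀ g : StrongDual ℝ X, g x ≤ q g) ∧ c < f x := by
  obtain ⟨-, p, -, hp⟩ := hq
  obtain ⟨_, ⟨x, hx, rfl⟩, hcx, -⟩ := (hp f).exists_between hc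
  have hle : ∀ g : StrongDual ℝ X, |g x| ≤ q g := fun g => (hp g).1 ⟨x, hx, rfl⟩
  rcases le_total 0 (f x) with h | h
  · exact ⟨x, fun g => (le_abs_self _).trans (hle g), by rwa [abs_of_nonneg h] at hcx⟩
  · refine ⟨-x, fun g => ?_, by rw [map_neg]; rwa [abs_of_nonpos h] at hcx⟩
    rw [map_neg]
    exact (neg_le_abs _).trans (hle g)

/-- Every point of the unit sphere of a dual norm is removed from the unit ball after finitely many
slice derivations with respect to an open cover of the sphere. -/
theorem IsEquivalentDualNorm.exists_slice_iterate {q : Seminorm ℝ (StrongDual ℝ X)}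
    (hq : IsEquivalentDualNorm q) {V : ι → Set (WeakDual ℝ X)} (hV : ∀ i, IsOpen (V i))
    (hcov : ∀ f ∈ weakStarUnitSphere q, ∃ i, f ∈ V i) (h0 : ∀ i, (0 : WeakDual ℝ X) ∉ V i)
    {B : Set (WeakDual ℝ X)} (hB : B = {f | q (WeakDual.toStrongDual f) ≤ 1})
    {f : WeakDual ℝ X} (hf : f ∈ weakStarUnitSphere q) :
    ∃ (j : ℕ) (s : X × ℝ), f ∈ (sliceDerivative V)^[j] B ∧
      s ∈ sliceFamily V ((sliceDerivative V)^[j] B) ∧ s.2 < f s.1 := by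
  have hspec := iterate_sliceDerivative_spec (hB ▸ hq.isCompact_sublevel 1)
    (hB ▸ q.convex_sublevel_toStrongDual 1) (by simp [hB]) V (C := B)
  by_contra! hcon
  have hfB : ∀ j, f ∈ (sliceDerivative V)^[j] B := fun j => by
    induction j with
    | zero => rw [Function.iterate_zero, id, hB]; exact le_of_eq hf
    | succ j ih => rw [Function.iterate_succ_apply']; exact ⟨ih, fun s hs => hcon j s ih hs⟩
  set D : Set (WeakDual ℝ X) := ⋂ j, (sliceDerivative V)^[j] B with hD
  have hDc : IsCompact D := (hspec 0).1.of_isClosed_subset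
    (isClosed_iInter fun j => (hspec j).1.isClosed) (Set.iInter_subset _ 0)
  have hDconv : Convex ℝ D := convex_iInter fun j => (hspec j).2.1
  have hD0 : (0 : WeakDual ℝ X) ∈ D := Set.mem_iInter.2 fun j => (hspec j).2.2.1
  have hDB : ∀ g ∈ D, q (WeakDual.toStrongDual g) ≤ 1 := fun g hg => by
    have := (hspec 0).2.2.2 (Set.mem_iInter.1 hg 0)
    rwa [hB] at this
  have hf1 : q (WeakDual.toStrongDual f) = 1 := hf
  have hz : ∀ j : ℕ, ∃ x : X, (∀ g : StrongDual ℝ X, g x ≤ q g) ∧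
      1 - (1 / 2 : ℝ) ^ j < WeakDual.toStrongDual f x := fun j =>
    hq.exists_eval_gt (by rw [hf1, sub_lt_self_iff]; positivity)
  choose z hzq hzf using hz
  obtain ⟨e, he, hlim⟩ := WeakDual.exists_extremePoint_tendsto_one hDc z
    (fun g hg j => (hzq j (WeakDual.toStrongDual g)).trans (hDB g hg))
    (Set.mem_iInter.2 hfB) (fun j => (hzf j).le)
  have heD : e ∈ D := extremePoints_subset he
  have heS : e ∈ weakStarUnitSphere q :=
    le_antisymm (hDB e heD) (le_of_tendsto' hlim fun j => hzq j (WeakDual.toStrongDual e))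
  obtain ⟨i, hi⟩ := hcov e heS
  obtain ⟨h, u, heu, hsl⟩ := WeakDual.exists_slice_of_mem_extremePoints hDc hDconv he (hV i) hi
  -- At a negative level the slice would contain the origin, which no member of `V` does.
  have hu : 0 ≤ u := by
    by_contra! hneg
    exact h0 i (hsl 0 hD0 (show u ≤ 0 from hneg.le))
  -- The closed slice of `D` is the decreasing intersection of the slices of the iterates, so by
  -- compactness one of these already lies in `V i`.
  have hanti : Antitone fun j => (sliceDerivative V)^[j] B ∩ {g | u ≤ g h} :=
    antitone_nat_of_succ_le fun j => by
      rw [Function.iterate_succ_apply']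
      exact Set.inter_subset_inter_left _ fun g hg => hg.1
  have hclosed : IsClosed {g : WeakDual ℝ X | u ≤ g h} :=
    isClosed_le continuous_const (WeakDual.eval_continuous h)
  obtain ⟨j, hj⟩ := exists_subset_nhds_of_isCompact'
    (V := fun j => (sliceDerivative V)^[j] B ∩ {g | u ≤ g h}) hanti.directed_ge
    (fun j => (hspec j).1.inter_right hclosed)
    (fun j => (hspec j).1.isClosed.inter hclosed) (U := V i) (fun g hg => by
      have hg' := Set.mem_iInter.1 hg
      exact (hV i).mem_nhds (hsl g (Set.mem_iInter.2 fun j => (hg' j).1) (hg' 0).2))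
  -- Rescaling makes the normal admissible; the `+ 1` covers `h = 0`.
  have hpos : 0 < (‖h‖ + 1)⁻¹ := by positivity
  have hmem : ((‖h‖ + 1)⁻¹ • h, (‖h‖ + 1)⁻¹ * u) ∈
      sliceFamily V ((sliceDerivative V)^[j] B) := by
    refine ⟨?_, by positivity, i, fun g hg hgu => hj ⟨hg, ?_⟩⟩
    · rw [norm_smul, Real.norm_of_nonneg hpos.le, inv_mul_le_iff₀ (by positivity)]
      linarith
    · simp only [map_smul, smul_eq_mul] at hgu
      exact (lt_of_mul_lt_mul_left hgu hpos.le).le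
  have hej : e ∈ (sliceDerivative V)^[j + 1] B := Set.mem_iInter.1 heD (j + 1)
  rw [Function.iterate_succ_apply'] at hej
  have := hej.2 _ hmem
  simp only [map_smul, smul_eq_mul] at this
  exact absurd (le_of_mul_le_mul_left this hpos) (not_le.2 heu)

end SliceDerivative

/-! ### Reduction to the sphere, and norms from convex functions. -/

section ConvexRenorming

variable {X : Type*} [NormedAddCommGroup X] [NormedSpace ℝ X]

/-- The defect dominates `(q (u n) - q f) ^ 2`, so `q (u n) → q f` and `q (f + u n) → 2 * q f`.
Normalizing then costs only a vanishing error; for `f = 0` the convergence is in norm. -/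
theorem isWeakStarLUR_of_sphere {q : Seminorm ℝ (StrongDual ℝ X)} (hq : IsEquivalentNorm q)
    (h : ∀ (f : StrongDual ℝ X) (v : ℕ → StrongDual ℝ X), q f = 1 → (∀ n, q (v n) = 1) →
      Tendsto (fun n => q (f + v n)) atTop (𝓝 2) →
      Tendsto (fun n => StrongDual.toWeakDual (v n)) atTop (𝓝 (StrongDual.toWeakDual f))) :
    IsWeakStarLUR q := by
  intro f u hu
  have hb0 : ∀ n, 0 ≤ q (u n) := fun n => apply_nonneg q _
  have ha0 : 0 ≤ q f := apply_nonneg q _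
  have hc0 : ∀ n, 0 ≤ q (f + u n) := fun n => apply_nonneg q _
  have hcle : ∀ n, q (f + u n) ≤ q f + q (u n) := fun n => map_add_le_add q _ _
  have hsq : Tendsto (fun n => (q (u n) - q f) ^ 2) atTop (𝓝 0) :=
    squeeze_zero (fun n => sq_nonneg _) (fun n => by nlinarith [hcle n, hc0 n]) hu
  have hb : Tendsto (fun n => q (u n)) atTop (𝓝 (q f)) := by
    have h1 := hsq.sqrt
    simp only [Real.sqrt_sq_eq_abs, Real.sqrt_zero] at h1
    have h2 := (tendsto_zero_iff_abs_tendsto_zero _).2 h1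
    simpa using h2.add_const (q f)
  have hc : Tendsto (fun n => q (f + u n)) atTop (𝓝 (2 * q f)) := by
    have h1 : Tendsto (fun n => q (f + u n) ^ 2) atTop (𝓝 ((2 * q f) ^ 2)) := by
      have := ((tendsto_const_nhds (x := 2 * q f ^ 2)).add ((hb.pow 2).const_mul 2)).sub hu
      simp only [sub_sub_cancel, sub_zero] at this
      convert this using 2
      ring
    have h2 := h1.sqrt
    rw [Real.sqrt_sq (by positivity)] at h2
    exact h2.congr fun n => Real.sqrt_sq (hc0 n)
  rcases ha0.eq_or_lt with hf | hf
  · obtain ⟨c, C, hcpos, -, hqe⟩ := id hq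
    have hf0 : f = 0 := hq.eq_zero_of_map_eq_zero hf.symm
    rw [← hf] at hb
    have hn : Tendsto (fun n => ‖u n‖) atTop (𝓝 0) := by
      refine squeeze_zero (fun n => norm_nonneg _) (fun n => ?_)
        (by simpa using hb.const_mul c⁻¹)
      rw [le_inv_mul_iff₀ hcpos]
      exact (hqe _).1
    rw [hf0]
    exact (NormedSpace.Dual.toWeakDual_continuous.tendsto 0).comp
      (tendsto_zero_iff_norm_tendsto_zero.2 hn)
  -- The default keeps `v n` on the sphere when `q (u n) = 0`, which happens only finitely often.
  · set v : ℕ → StrongDual ℝ X := fun n =>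
      if q (u n) = 0 then (q f)⁻¹ • f else (q (u n))⁻¹ • u n with hv
    have hf1 : q ((q f)⁻¹ • f) = 1 := by
      rw [map_smul_eq_mul, Real.norm_of_nonneg (by positivity), inv_mul_cancel₀ hf.ne']
    have hv1 : ∀ n, q (v n) = 1 := fun n => by
      by_cases h0 : q (u n) = 0
      · simp only [hv, h0, if_true, hf1]
      · simp only [hv, h0, if_false]
        rw [map_smul_eq_mul, Real.norm_of_nonneg (inv_nonneg.2 (hb0 n)), inv_mul_cancel₀ h0]
    have hpos : ∀ᶠ n in atTop, 0 < q (u n) := hb.eventually_const_lt hf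
    have hlow : Tendsto (fun n => (q f)⁻¹ * q (f + u n) - |(q f)⁻¹ - (q (u n))⁻¹| * q (u n)) atTop
        (𝓝 2) := by
      have := (hc.const_mul (q f)⁻¹).sub
        (((tendsto_const_nhds (x := (q f)⁻¹)).sub (hb.inv₀ hf.ne')).abs.mul hb)
      simp only [sub_self, abs_zero, zero_mul, sub_zero] at this
      convert this using 2
      field_simp
    have hlim := h _ v hf1 hv1 (by
      refine tendsto_of_tendsto_of_tendsto_of_le_of_le' hlow tendsto_const_nhds ?_
        (Eventually.of_forall fun n => ?_)
      · filter_upwards [hpos] with n hn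
        have hvn : v n = (q (u n))⁻¹ • u n := by simp only [hv, hn.ne', if_false]
        have hdec : (q f)⁻¹ • (f + u n) =
            ((q f)⁻¹ • f + v n) + ((q f)⁻¹ - (q (u n))⁻¹) • u n := by
          rw [hvn]; module
        have := map_add_le_add q ((q f)⁻¹ • f + v n) (((q f)⁻¹ - (q (u n))⁻¹) • u n)
        rw [← hdec, map_smul_eq_mul, map_smul_eq_mul, Real.norm_of_nonneg (by positivity),
          Real.norm_eq_abs] at this
        linarith
      · linarith [map_add_le_add q ((q f)⁻¹ • f) (v n), hv1 n])
    have hfin := hb.smul hlim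
    rw [← map_smul, smul_inv_smul₀ hf.ne'] at hfin
    refine hfin.congr' ?_
    filter_upwards [hpos] with n hn
    simp only [hv, hn.ne', if_false]
    rw [← map_smul, smul_inv_smul₀ hn.ne']

/-- A closed, convex, balanced and bounded neighbourhood of the origin is the unit ball of an
equivalent norm. -/
theorem exists_isEquivalentNorm_of_convex_body {E : Type*} [NormedAddCommGroup E]
    [NormedSpace ℝ E] {A : Set E} (hcl : IsClosed A) (hconv : Convex ℝ A) (hbal : Balanced ℝ A)
    {K : ℝ} (hK : 0 < K) (hball : Metric.ball (0 : E) (1 / K) ⊆ A)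
    (hunit : A ⊆ Metric.closedBall 0 1) :
    ∃ q : Seminorm ℝ E, IsEquivalentNorm q ∧ ∀ f, q f ≤ 1 ↔ f ∈ A := by
  have hnhds : A ∈ 𝓝 (0 : E) := mem_of_superset (Metric.ball_mem_nhds _ (by positivity)) hball
  have habs : Absorbent ℝ A := absorbent_nhds_zero hnhds
  refine ⟨gaugeSeminorm hbal hconv habs, ⟨1, K, one_pos, hK, fun f => ⟨?_, ?_⟩⟩, fun f => ?_⟩
  · have := le_gauge_of_subset_closedBall habs zero_le_one hunit (x := f)
    rw [div_one] at this
    rw [one_mul]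
    exact this
  · have := mul_gauge_le_norm hball (x := f)
    rw [div_mul_eq_mul_div, one_mul, div_le_iff₀ hK] at this
    rw [mul_comm]
    exact this
  · have := gauge_le_one_iff_mem_closure hconv hnhds (x := f)
    rw [hcl.closure_eq] at this
    exact this

/-- A weak* lower semicontinuous even convex function comparable to the square of the norm defines
an equivalent dual norm through its sublevel set. -/
theorem exists_dualNorm_of_convex {Φ : WeakDual ℝ X → ℝ} {K : ℝ} (hK : 1 ≤ K)
    (hconv : ConvexOn ℝ Set.univ Φ) (heven : ∀ g, Φ (-g) = Φ g)
    (hlow : ∀ g, ‖WeakDual.toStrongDual g‖ ^ 2 ≤ Φ g)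
    (hup : ∀ g, Φ g ≤ K * ‖WeakDual.toStrongDual g‖ ^ 2) (hcl : IsClosed {g | Φ g ≤ 1}) :
    ∃ q : Seminorm ℝ (StrongDual ℝ X), IsEquivalentDualNorm q ∧
      (∀ f, q f ≤ 1 → Φ (StrongDual.toWeakDual f) ≤ 1) ∧
      ∀ m : ℕ → StrongDual ℝ X, (∀ n, q (m n) ≤ 1) → Tendsto (fun n => q (m n)) atTop (𝓝 1) →
        ∀ ε > 0, ∀ᶠ n in atTop, 1 - ε < Φ (StrongDual.toWeakDual (m n)) := by
  have hΦ0 : Φ 0 = 0 := le_antisymm (by simpa using hup 0) (by simpa using hlow 0)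
  have hsmul : ∀ (g : WeakDual ℝ X) (a : ℝ), 0 ≤ a → a ≤ 1 → Φ (a • g) ≤ a * Φ g := by
    intro g a ha ha1
    have := hconv.2 (Set.mem_univ g) (Set.mem_univ 0) ha (sub_nonneg.2 ha1) (by ring)
    simpa [hΦ0] using this
  have hnonneg : ∀ g, 0 ≤ Φ g := fun g => (sq_nonneg _).trans (hlow g)
  set A : Set (StrongDual ℝ X) := {f | Φ (StrongDual.toWeakDual f) ≤ 1} with hA
  have hAcl : IsClosed A := hcl.preimage NormedSpace.Dual.toWeakDual_continuous
  have hAconv : Convex ℝ A := by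
    intro f hf g hg a b ha hb hab
    have h1 := hconv.2 (Set.mem_univ (StrongDual.toWeakDual f))
      (Set.mem_univ (StrongDual.toWeakDual g)) ha hb hab
    rw [← map_smul, ← map_smul, ← map_add] at h1
    refine h1.trans ?_
    have hf' : Φ (StrongDual.toWeakDual f) ≤ 1 := hf
    have hg' : Φ (StrongDual.toWeakDual g) ≤ 1 := hg
    simp only [smul_eq_mul]
    nlinarith
  have hbal : Balanced ℝ A := by
    rw [balanced_iff_smul_mem]
    intro a ha f hf
    rw [Real.norm_eq_abs] at ha
    have hf' : Φ (StrongDual.toWeakDual f) ≤ 1 := hf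
    have h1 : Φ (|a| • StrongDual.toWeakDual f) ≤ 1 :=
      (hsmul _ _ (abs_nonneg a) ha).trans
        (mul_le_one₀ ha (hnonneg _) hf')
    change Φ (StrongDual.toWeakDual (a • f)) ≤ 1
    rw [map_smul]
    rcases abs_choice a with h | h
    · rwa [h] at h1
    · rw [h, neg_smul, heven] at h1
      exact h1
  have hball : Metric.ball (0 : StrongDual ℝ X) (1 / K) ⊆ A := by
    intro f hf
    rw [mem_ball_zero_iff, lt_div_iff₀ (by linarith)] at hf
    refine (hup _).trans ?_
    rw [StrongDual.toStrongDual_toWeakDual]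
    nlinarith [norm_nonneg f]
  have hunit : A ⊆ Metric.closedBall 0 1 := by
    intro f hf
    rw [mem_closedBall_zero_iff]
    have := (hlow _).trans hf
    rw [StrongDual.toStrongDual_toWeakDual] at this
    nlinarith [norm_nonneg f]
  obtain ⟨q, hqe, hqA⟩ := exists_isEquivalentNorm_of_convex_body hAcl hAconv hbal
    (zero_lt_one.trans_le hK) hball hunit
  refine ⟨q, hqe.isEquivalentDualNorm ?_, fun f hf => (hqA f).1 hf, fun m hm hlim ε hε => ?_⟩
  · convert hcl using 1
    ext g
    exact hqA _
  -- If `q (m n) > (1 + θ)⁻¹`, then `Φ` exceeds `1` at `(1 + θ) • g`. Convexity between `g` and `2 •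
  -- g`, where `Φ ≤ 4 * K`, gives `1 < Φ g + θ * (4 * K) ≤ Φ g + ε`.
  · set θ : ℝ := min 1 (ε / (4 * K)) with hθ
    have hθ0 : 0 < θ := lt_min one_pos (by positivity)
    have hθ1 : θ ≤ 1 := min_le_left _ _
    have hθε : θ * (4 * K) ≤ ε := (le_div_iff₀ (by positivity)).1 (min_le_right _ _)
    have hev : ∀ᶠ n in atTop, (1 + θ)⁻¹ < q (m n) :=
      hlim.eventually_const_lt (inv_lt_one_of_one_lt₀ (by linarith))
    filter_upwards [hev] with n hn
    set g := StrongDual.toWeakDual (m n) with hg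
    have hgA : Φ g ≤ 1 := (hqA _).1 (hm n)
    have hout : 1 < Φ ((1 + θ) • g) := by
      by_contra! hle
      have : q ((1 + θ) • m n) ≤ 1 := (hqA _).2 (by rw [hg, ← map_smul] at hle; exact hle)
      rw [map_smul_eq_mul, Real.norm_of_nonneg (by linarith)] at this
      rw [inv_lt_iff_one_lt_mul₀ (by linarith)] at hn
      linarith
    have hdouble : Φ ((2 : ℝ) • g) ≤ 4 * K := by
      refine (hup _).trans ?_
      rw [map_smul, norm_smul, mul_pow]
      have h1 := (hlow g).trans hgA
      norm_num
      nlinarith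
    have hcomb := hconv.2 (Set.mem_univ g) (Set.mem_univ ((2 : ℝ) • g)) (sub_nonneg.2 hθ1) hθ0.le
      (by ring)
    have heq : (1 - θ) • g + θ • (2 : ℝ) • g = (1 + θ) • g := by module
    rw [heq] at hcomb
    simp only [smul_eq_mul] at hcomb
    nlinarith [hnonneg g]

end ConvexRenorming

/-! ### Depth functions of half-spaces and their encoding in a norm. -/

section SliceFunctions

variable {X : Type*} [NormedAddCommGroup X] [NormedSpace ℝ X]

/-- The depth of `g` inside the half-space `{g | s.2 < g s.1}`. -/
noncomputable def sliceDepth (s : X × ℝ) (g : WeakDual ℝ X) : ℝ := max (g s.1 - s.2) 0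

/-- The supremum of the squared depths over a family of half-spaces. -/
noncomputable def supSqDepth (F : Set (X × ℝ)) (g : WeakDual ℝ X) : ℝ :=
  ⨆ s : F, sliceDepth s.1 g ^ 2

/-- The convexity defect of `supSqDepth F` at the midpoint of `f` and `g`. -/
noncomputable def depthDefect (F : Set (X × ℝ)) (f g : WeakDual ℝ X) : ℝ :=
  (1 / 2 : ℝ) * supSqDepth F f + (1 / 2 : ℝ) * supSqDepth F g -
    supSqDepth F ((1 / 2 : ℝ) • f + (1 / 2 : ℝ) • g)

/-- A nonempty family of half-spaces with normalized normals not containing the origin. -/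
structure IsNormalizedFamily (F : Set (X × ℝ)) : Prop where
  nonempty : F.Nonempty
  norm_le : ∀ s ∈ F, ‖s.1‖ ≤ 1
  nonneg : ∀ s ∈ F, 0 ≤ s.2

theorem sliceDepth_nonneg (s : X × ℝ) (g : WeakDual ℝ X) : 0 ≤ sliceDepth s g := le_max_right _ _

theorem sliceDepth_combo_le (s : X × ℝ) (f g : WeakDual ℝ X) {a b : ℝ} (ha : 0 ≤ a) (hb : 0 ≤ b)
    (hab : a + b = 1) :
    sliceDepth s (a • f + b • g) ≤ a * sliceDepth s f + b * sliceDepth s g := by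
  have h1 : f s.1 - s.2 ≤ sliceDepth s f := le_max_left _ _
  have h2 : g s.1 - s.2 ≤ sliceDepth s g := le_max_left _ _
  refine max_le ?_ (add_nonneg (mul_nonneg ha (sliceDepth_nonneg s f))
    (mul_nonneg hb (sliceDepth_nonneg s g)))
  rw [WeakDual.combo_apply]
  calc a * f s.1 + b * g s.1 - s.2 = a * (f s.1 - s.2) + b * (g s.1 - s.2) := by
        linear_combination s.2 * hab
    _ ≤ _ := by gcongr

theorem continuous_sliceDepth (s : X × ℝ) : Continuous (sliceDepth s) :=
  ((WeakDual.eval_continuous s.1).sub continuous_const).max continuous_const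

namespace IsNormalizedFamily

variable {F : Set (X × ℝ)} (hF : IsNormalizedFamily F)
include hF

theorem sliceDepth_sq_le {s : X × ℝ} (hs : s ∈ F) (g : WeakDual ℝ X) :
    sliceDepth s g ^ 2 ≤ ‖WeakDual.toStrongDual g‖ ^ 2 := by
  refine pow_le_pow_left₀ (sliceDepth_nonneg s g) (max_le ?_ (norm_nonneg _)) 2
  have h1 : g s.1 ≤ ‖WeakDual.toStrongDual g‖ * ‖s.1‖ :=
    (le_abs_self _).trans ((WeakDual.toStrongDual g).le_opNorm s.1)
  nlinarith [hF.norm_le s hs, hF.nonneg s hs, norm_nonneg (WeakDual.toStrongDual g)]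

theorem bddAbove (g : WeakDual ℝ X) : BddAbove (Set.range fun s : F => sliceDepth s.1 g ^ 2) :=
  ⟨_, by rintro _ ⟨s, rfl⟩; exact hF.sliceDepth_sq_le s.2 g⟩

theorem sq_le_supSqDepth {s : X × ℝ} (hs : s ∈ F) (g : WeakDual ℝ X) :
    sliceDepth s g ^ 2 ≤ supSqDepth F g :=
  le_ciSup (hF.bddAbove g) ⟨s, hs⟩

theorem supSqDepth_le {g : WeakDual ℝ X} {c : ℝ} (h : ∀ s ∈ F, sliceDepth s g ^ 2 ≤ c) :
    supSqDepth F g ≤ c :=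
  have := hF.nonempty.to_subtype
  ciSup_le fun s => h s.1 s.2

theorem exists_lt_sq {g : WeakDual ℝ X} {c : ℝ} (h : c < supSqDepth F g) :
    ∃ s ∈ F, c < sliceDepth s g ^ 2 := by
  have := hF.nonempty.to_subtype
  obtain ⟨s, hs⟩ := exists_lt_of_lt_ciSup h
  exact ⟨s.1, s.2, hs⟩

theorem supSqDepth_nonneg (g : WeakDual ℝ X) : 0 ≤ supSqDepth F g := by
  obtain ⟨s, hs⟩ := hF.nonempty
  exact (sq_nonneg _).trans (hF.sq_le_supSqDepth hs g)

theorem supSqDepth_le_norm_sq (g : WeakDual ℝ X) :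
    supSqDepth F g ≤ ‖WeakDual.toStrongDual g‖ ^ 2 :=
  hF.supSqDepth_le fun _ hs => hF.sliceDepth_sq_le hs g

theorem lowerSemicontinuous : LowerSemicontinuous (supSqDepth F) :=
  lowerSemicontinuous_ciSup hF.bddAbove
    fun s => ((continuous_sliceDepth s.1).pow 2).lowerSemicontinuous

theorem lowerSemicontinuous_comp_neg : LowerSemicontinuous fun g => supSqDepth F (-g) :=
  lowerSemicontinuous_ciSup (fun g => hF.bddAbove (-g))
    fun s => (((continuous_sliceDepth s.1).comp continuous_neg).pow 2).lowerSemicontinuous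

theorem convexOn : ConvexOn ℝ Set.univ (supSqDepth F) := by
  refine ⟨convex_univ, fun f _ g _ a b ha hb hab => hF.supSqDepth_le fun s hs => ?_⟩
  have h1 := sliceDepth_combo_le s f g ha hb hab
  have h2 := (convexOn_pow (𝕜 := ℝ) 2).2 (sliceDepth_nonneg s f) (sliceDepth_nonneg s g) ha hb hab
  refine (pow_le_pow_left₀ (sliceDepth_nonneg _ _) h1 2).trans (h2.trans ?_)
  simp only [smul_eq_mul]
  gcongr
  · exact hF.sq_le_supSqDepth hs f
  · exact hF.sq_le_supSqDepth hs g

theorem depthDefect_nonneg (f g : WeakDual ℝ X) : 0 ≤ depthDefect F f g :=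
  sub_nonneg.2 (hF.convexOn.2 (Set.mem_univ f) (Set.mem_univ g) (by norm_num) (by norm_num)
    (by norm_num))

/-- Take `s` nearly attaining the supremum at the midpoint. For depths `a`, `b` at `f`, `g`, the
identity `(a² + b²)/2 - ((a + b)/2)² = (a - b)²/4` bounds both losses. -/
theorem exists_of_depthDefect_lt {f g : WeakDual ℝ X} {δ : ℝ} (h : depthDefect F f g < δ) :
    ∃ s ∈ F, supSqDepth F f < sliceDepth s f ^ 2 + 2 * δ ∧
      (sliceDepth s f - sliceDepth s g) ^ 2 < 4 * δ := by
  obtain ⟨s, hs, hlt⟩ := hF.exists_lt_sq (g := (1 / 2 : ℝ) • f + (1 / 2 : ℝ) • g)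
    (c := (1 / 2 : ℝ) * supSqDepth F f + (1 / 2 : ℝ) * supSqDepth F g - δ)
    (by unfold depthDefect at h; linarith)
  have h1 := sliceDepth_combo_le s f g (a := 1 / 2) (b := 1 / 2) (by norm_num) (by norm_num)
    (by norm_num)
  have h2 := pow_le_pow_left₀ (sliceDepth_nonneg _ _) h1 2
  have hf := hF.sq_le_supSqDepth hs f
  have hg := hF.sq_le_supSqDepth hs g
  exact ⟨s, hs, by nlinarith [sq_nonneg (sliceDepth s f - sliceDepth s g)], by nlinarith⟩

/-- Depth zero at `f` at least halves every depth at the midpoint, so the defect is at least `1/2 -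
1/4` of the value at `g`. -/
theorem supSqDepth_le_of_eq_zero {f g : WeakDual ℝ X} (h : supSqDepth F f = 0) :
    supSqDepth F g ≤ 4 * depthDefect F f g := by
  have hmid : supSqDepth F ((1 / 2 : ℝ) • f + (1 / 2 : ℝ) • g) ≤ (1 / 4 : ℝ) * supSqDepth F g := by
    refine hF.supSqDepth_le fun s hs => ?_
    have h0 : sliceDepth s f = 0 :=
      pow_eq_zero_iff two_ne_zero |>.1 (le_antisymm (h ▸ hF.sq_le_supSqDepth hs f) (sq_nonneg _))
    have h1 := sliceDepth_combo_le s f g (a := 1 / 2) (b := 1 / 2) (by norm_num) (by norm_num)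
      (by norm_num)
    have h2 := pow_le_pow_left₀ (sliceDepth_nonneg _ _) h1 2
    rw [h0] at h2
    nlinarith [hF.sq_le_supSqDepth hs g]
  unfold depthDefect
  rw [h]
  linarith

end IsNormalizedFamily

theorem lowerSemicontinuous_norm_sq_toStrongDual :
    LowerSemicontinuous fun g : WeakDual ℝ X => ‖WeakDual.toStrongDual g‖ ^ 2 := by
  have h1 : LowerSemicontinuous fun g : WeakDual ℝ X => ‖WeakDual.toStrongDual g‖ := by
    rw [lowerSemicontinuous_iff_isClosed_preimage]
    intro r
    convert WeakDual.isClosed_closedBall (𝕜 := ℝ) (0 : StrongDual ℝ X) r using 1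
    ext g
    simp
  -- Truncation at `0` makes squaring monotone on all of `ℝ`.
  have h2 := (continuous_id.max continuous_const |>.pow 2 :
    Continuous fun t : ℝ => (max t 0) ^ 2).comp_lowerSemicontinuous h1
    (fun a b hab => pow_le_pow_left₀ (le_max_right _ _) (max_le_max_right 0 hab) 2)
  simpa [Function.comp_def] using h2

/-- Countably many families of half-spaces can be encoded in one dual norm: local uniform rotundity
of that norm controls the convexity defects of all the families. -/
theorem exists_dualNorm_of_families {ι : Type*} [Countable ι] {F : ι → Set (X × ℝ)}
    (hF : ∀ i, IsNormalizedFamily (F i)) :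
    ∃ q : Seminorm ℝ (StrongDual ℝ X), IsEquivalentDualNorm q ∧
      ∀ (f : StrongDual ℝ X) (v : ℕ → StrongDual ℝ X), q f = 1 → (∀ n, q (v n) = 1) →
        Tendsto (fun n => q (f + v n)) atTop (𝓝 2) → ∀ i, ∀ ε > 0, ∀ᶠ n in atTop,
          depthDefect (F i) (StrongDual.toWeakDual f) (StrongDual.toWeakDual (v n)) < ε := by
  have := Encodable.ofCountable ι
  obtain ⟨w, hw, c, hwc, -⟩ := posSumOfEncodable one_pos ι
  have hc : 0 ≤ c := hwc.nonneg fun i => (hw i).le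
  set G : ι → WeakDual ℝ X → ℝ := fun i g => w i * (supSqDepth (F i) g + supSqDepth (F i) (-g))
    with hG
  have hneg : ∀ g : WeakDual ℝ X, ‖WeakDual.toStrongDual (-g)‖ = ‖WeakDual.toStrongDual g‖ :=
    fun g => by rw [map_neg, norm_neg]
  have hG0 : ∀ i g, 0 ≤ G i g := fun i g => mul_nonneg (hw i).le
    (add_nonneg ((hF i).supSqDepth_nonneg g) ((hF i).supSqDepth_nonneg (-g)))
  have hGle : ∀ i g, G i g ≤ w i * (2 * ‖WeakDual.toStrongDual g‖ ^ 2) := fun i g => by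
    have h1 := (hF i).supSqDepth_le_norm_sq g
    have h2 := (hF i).supSqDepth_le_norm_sq (-g)
    rw [hneg] at h2
    exact mul_le_mul_of_nonneg_left (by linarith) (hw i).le
  have hGsum : ∀ g, Summable fun i => G i g := fun g =>
    Summable.of_nonneg_of_le (fun i => hG0 i g) (fun i => hGle i g)
      (hwc.summable.mul_right _)
  have hGconv : ∀ i (f g : WeakDual ℝ X) (a b : ℝ), 0 ≤ a → 0 ≤ b → a + b = 1 →
      G i (a • f + b • g) ≤ a * G i f + b * G i g := fun i f g a b ha hb hab => by
    have h1 := (hF i).convexOn.2 (Set.mem_univ f) (Set.mem_univ g) ha hb hab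
    have h2 := (hF i).convexOn.2 (Set.mem_univ (-f)) (Set.mem_univ (-g)) ha hb hab
    have h3 : a • -f + b • -g = -(a • f + b • g) := by module
    rw [h3] at h2
    simp only [smul_eq_mul] at h1 h2
    calc _ ≤ w i * ((a * supSqDepth (F i) f + b * supSqDepth (F i) g) +
          (a * supSqDepth (F i) (-f) + b * supSqDepth (F i) (-g))) :=
          mul_le_mul_of_nonneg_left (add_le_add h1 h2) (hw i).le
      _ = _ := by simp only [hG]; ring
  set Φ : WeakDual ℝ X → ℝ := fun g => ‖WeakDual.toStrongDual g‖ ^ 2 + ∑' i, G i g with hΦ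
  have hnormconv : ∀ (f g : WeakDual ℝ X) (a b : ℝ), 0 ≤ a → 0 ≤ b → a + b = 1 →
      ‖WeakDual.toStrongDual (a • f + b • g)‖ ^ 2 ≤
        a * ‖WeakDual.toStrongDual f‖ ^ 2 + b * ‖WeakDual.toStrongDual g‖ ^ 2 :=
    fun f g a b ha hb hab => by
    have h1 : ‖WeakDual.toStrongDual (a • f + b • g)‖ ≤
        a * ‖WeakDual.toStrongDual f‖ + b * ‖WeakDual.toStrongDual g‖ := by
      rw [map_add, map_smul, map_smul]
      refine (norm_add_le _ _).trans (le_of_eq ?_)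
      rw [norm_smul, norm_smul, Real.norm_of_nonneg ha, Real.norm_of_nonneg hb]
    exact (pow_le_pow_left₀ (norm_nonneg _) h1 2).trans
      ((convexOn_pow (𝕜 := ℝ) 2).2 (norm_nonneg (WeakDual.toStrongDual f))
        (norm_nonneg (WeakDual.toStrongDual g)) ha hb hab)
  -- All summands of `Φ` are convex, so each individual defect is bounded by the total one.
  have hsumconv : ∀ (f g : WeakDual ℝ X) (a b : ℝ), 0 ≤ a → 0 ≤ b → a + b = 1 → ∀ i,
      a * G i f + b * G i g - G i (a • f + b • g) ≤ a * Φ f + b * Φ g - Φ (a • f + b • g) :=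
    fun f g a b ha hb hab i => by
    have h1 : HasSum (fun i => a * G i f + b * G i g - G i (a • f + b • g))
        (a * ∑' i, G i f + b * ∑' i, G i g - ∑' i, G i (a • f + b • g)) :=
      (((hGsum f).hasSum.mul_left a).add ((hGsum g).hasSum.mul_left b)).sub (hGsum _).hasSum
    have h2 := le_hasSum h1 i fun j _ => sub_nonneg.2 (hGconv j f g a b ha hb hab)
    have h3 := hnormconv f g a b ha hb hab
    simp only [hΦ]
    linarith
  have hΦconv : ConvexOn ℝ Set.univ Φ := by
    refine ⟨convex_univ, fun f _ g _ a b ha hb hab => ?_⟩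
    have h1 : ∑' i, G i (a • f + b • g) ≤ a * ∑' i, G i f + b * ∑' i, G i g :=
      hasSum_le (fun i => hGconv i f g a b ha hb hab) (hGsum _).hasSum
        (((hGsum f).hasSum.mul_left a).add ((hGsum g).hasSum.mul_left b))
    have h3 := hnormconv f g a b ha hb hab
    simp only [hΦ, smul_eq_mul]
    linarith
  have hΦcl : IsClosed {g | Φ g ≤ 1} := by
    have : {g | Φ g ≤ 1} = ⋂ t : Finset ι,
        {g | ‖WeakDual.toStrongDual g‖ ^ 2 + ∑ i ∈ t, G i g ≤ 1} := by
      ext g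
      simp only [Set.mem_ofPred_eq, Set.mem_iInter, hΦ]
      constructor
      · intro h t
        have := (hGsum g).sum_le_tsum t fun i _ => hG0 i g
        linarith
      · intro h
        have := (hGsum g).tsum_le_of_sum_le (a₂ := 1 - ‖WeakDual.toStrongDual g‖ ^ 2)
          fun t => by linarith [h t]
        linarith
    rw [this]
    refine isClosed_iInter fun t => LowerSemicontinuous.isClosed_preimage
      (lowerSemicontinuous_norm_sq_toStrongDual.add (lowerSemicontinuous_sum fun i _ => ?_)) 1
    refine (continuous_const_mul (w i)).comp_lowerSemicontinuous
      ((hF i).lowerSemicontinuous.add (hF i).lowerSemicontinuous_comp_neg)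
      (monotone_mul_left_of_nonneg (hw i).le)
  obtain ⟨q, hq, hqΦ, hlim⟩ := exists_dualNorm_of_convex (Φ := Φ) (K := 1 + 2 * c) (by linarith)
    hΦconv (fun g => by simp only [hΦ, hG, hneg, neg_neg, add_comm])
    (fun g => le_add_of_nonneg_right (tsum_nonneg fun i => hG0 i g))
    (fun g => by
      have := hasSum_le (fun i => hGle i g) (hGsum g).hasSum (hwc.mul_right _)
      simp only [hΦ]
      linarith) hΦcl
  refine ⟨q, hq, fun f v hf hv ht i ε hε => ?_⟩
  have hmid : ∀ n, q ((1 / 2 : ℝ) • f + (1 / 2 : ℝ) • v n) = (1 / 2 : ℝ) * q (f + v n) :=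
    fun n => by rw [← smul_add, map_smul_eq_mul]; norm_num
  -- The midpoints have `q`-norm tending to `1`, so `Φ` there eventually exceeds `1 - w i * ε`,
  -- while `Φ ≤ 1` at both endpoints. The weighted `i`-th defect is thus below `w i * ε`.
  have hev := hlim (fun n => (1 / 2 : ℝ) • f + (1 / 2 : ℝ) • v n)
    (fun n => by rw [hmid]; linarith [map_add_le_add q f (v n), hv n])
    (by simp only [hmid]; simpa using ht.const_mul (1 / 2 : ℝ)) (w i * ε) (mul_pos (hw i) hε)
  filter_upwards [hev] with n hn
  rw [map_add, map_smul, map_smul] at hn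
  set f' := StrongDual.toWeakDual f
  set g' := StrongDual.toWeakDual (v n)
  have h1 : Φ f' ≤ 1 := hqΦ f hf.le
  have h2 : Φ g' ≤ 1 := hqΦ (v n) (hv n).le
  have h3 := hsumconv f' g' (1 / 2) (1 / 2) (by norm_num) (by norm_num) (by norm_num) i
  have h4 := (hF i).depthDefect_nonneg (-f') (-g')
  have h5 : (1 / 2 : ℝ) • -f' + (1 / 2 : ℝ) • -g' = -((1 / 2 : ℝ) • f' + (1 / 2 : ℝ) • g') := by
    module
  rw [depthDefect, h5] at h4
  have h6 : w i * depthDefect (F i) f' g' < w i * ε := by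
    have h7 := mul_nonneg (hw i).le h4
    simp only [hG] at h3
    unfold depthDefect
    linarith
  exact lt_of_mul_lt_mul_left h6 (hw i).le

end SliceFunctions

/-! ### Localizing a sequence in slices through the limit point. -/

section SliceLocalization

open scoped Pointwise

variable {X : Type*} [NormedAddCommGroup X] [NormedSpace ℝ X] {ι : Type*}

theorem IsCompact.isCompact_add_closedBall {C : Set (WeakDual ℝ X)} (hC : IsCompact C) (ε : ℝ) :
    IsCompact (C + WeakDual.toStrongDual ⁻¹' Metric.closedBall (0 : StrongDual ℝ X) ε) :=
  hC.add (WeakDual.isCompact_closedBall (𝕜 := ℝ) (0 : StrongDual ℝ X) ε)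

theorem WeakDual.mem_add_closedBall_iff {C : Set (WeakDual ℝ X)} {ε : ℝ} {g : WeakDual ℝ X} :
    g ∈ C + WeakDual.toStrongDual ⁻¹' Metric.closedBall (0 : StrongDual ℝ X) ε ↔
      ∃ b ∈ C, ‖WeakDual.toStrongDual (g - b)‖ ≤ ε := by
  rw [Set.mem_add]
  constructor
  · rintro ⟨b, hb, d, hd, rfl⟩
    refine ⟨b, hb, ?_⟩
    rw [add_sub_cancel_left]
    simpa using hd
  · rintro ⟨b, hb, hd⟩
    exact ⟨b, hb, g - b, by simpa using hd, add_sub_cancel _ _⟩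

/-- The half-spaces, with normalized normals, that do not meet `t • C`. -/
def disjointFamily (C : Set (WeakDual ℝ X)) (t : ℝ) : Set (X × ℝ) :=
  {s | ‖s.1‖ ≤ 1 ∧ 0 ≤ s.2 ∧ ∀ g ∈ C, t * g s.1 ≤ s.2}

/-- The slices contained in members of `V`, dilated by `t`, and a trivial half-space. -/
def dilatedSliceFamily (V : ι → Set (WeakDual ℝ X)) (C : Set (WeakDual ℝ X)) (t : ℝ) :
    Set (X × ℝ) :=
  insert 0 ((fun s : X × ℝ => (s.1, t * s.2)) '' sliceFamily V C)

theorem isNormalizedFamily_disjointFamily (C : Set (WeakDual ℝ X)) (t : ℝ) :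
    IsNormalizedFamily (disjointFamily C t) :=
  ⟨⟨0, by simp, le_rfl, by simp⟩, fun _ hs => hs.1, fun _ hs => hs.2.1⟩

theorem isNormalizedFamily_dilatedSliceFamily (V : ι → Set (WeakDual ℝ X))
    (C : Set (WeakDual ℝ X)) {t : ℝ} (ht : 0 ≤ t) :
    IsNormalizedFamily (dilatedSliceFamily V C t) := by
  refine ⟨⟨0, Set.mem_insert _ _⟩, ?_, ?_⟩
  · rintro s (rfl | ⟨s, hs, rfl⟩)
    · simp
    · exact hs.1
  · rintro s (rfl | ⟨s, hs, rfl⟩)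
    · exact le_rfl
    · exact mul_nonneg ht hs.2.1

/-- A functional lying deep in no half-space missing `t • C` is close in norm to `t • C`. -/
theorem exists_norm_sub_le_of_disjointFamily {C : Set (WeakDual ℝ X)} (hC : IsCompact C)
    (hconv : Convex ℝ C) (h0 : (0 : WeakDual ℝ X) ∈ C) {t ε : ℝ} (hε : 0 ≤ ε) {v : WeakDual ℝ X}
    (hv : ∀ s ∈ disjointFamily C t, v s.1 ≤ s.2 + ε) :
    ∃ b ∈ C, ‖WeakDual.toStrongDual (v - t • b)‖ ≤ ε := by
  set D := WeakDual.toStrongDual ⁻¹' Metric.closedBall (0 : StrongDual ℝ X) ε with hD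
  have hDconv : Convex ℝ D :=
    (convex_closedBall (0 : StrongDual ℝ X) ε).linear_preimage
      (WeakDual.toStrongDual (𝕜 := ℝ) (E := X)).toLinearMap
  by_contra! hcon
  have htC : IsCompact (t • C) := hC.smul t
  have hnot : v ∉ t • C + D := by
    rw [WeakDual.mem_add_closedBall_iff]
    rintro ⟨_, ⟨b, hb, rfl⟩, hle⟩
    exact absurd hle (not_le.2 (hcon b hb))
  obtain ⟨h, u, hu, huv⟩ := WeakDual.exists_eval_separation ((hconv.smul t).add hDconv)
    (htC.isCompact_add_closedBall ε).isClosed hnot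
  have hzero : (0 : WeakDual ℝ X) ∈ t • C := ⟨0, h0, smul_zero t⟩
  have h0D : (0 : WeakDual ℝ X) ∈ D := by simpa [hD] using hε
  obtain ⟨c, hc, hmax⟩ := htC.exists_isMaxOn ⟨0, hzero⟩ (WeakDual.eval_continuous h).continuousOn
  have hc0 : 0 ≤ c h := hmax hzero
  have hh : h ≠ 0 := by
    rintro rfl
    have := hu (0 + 0) (Set.add_mem_add hzero h0D)
    simp only [map_zero] at this huv
    linarith
  have hhn : 0 < ‖h‖ := norm_pos_iff.2 hh
  obtain ⟨d, hd1, hdh⟩ := exists_dual_vector'' ℝ h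
  have hdD : StrongDual.toWeakDual (ε • d) ∈ D := by
    simp only [hD, Set.mem_preimage, StrongDual.toStrongDual_toWeakDual, mem_closedBall_zero_iff,
      norm_smul, Real.norm_of_nonneg hε]
    nlinarith
  have h1 : c h + ε * ‖h‖ < u := by
    have h2 := hu _ (Set.add_mem_add hc hdD)
    have h3 : (c + StrongDual.toWeakDual (ε • d)) h = c h + ε * d h := rfl
    rw [h3, hdh] at h2
    exact h2
  -- The supporting half-space of `t • C` in direction `h` is admissible, and `v` exceeds its level
  -- by at most `ε`. Yet separation from the `ε`-enlargement requires more.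
  have hs := hv (‖h‖⁻¹ • h, ‖h‖⁻¹ * c h) (by
    refine ⟨?_, by positivity, fun g hg => ?_⟩
    · rw [norm_smul, norm_inv, norm_norm, inv_mul_cancel₀ hhn.ne']
    · have h4 : (t • g) h ≤ c h := hmax (Set.smul_mem_smul_set hg)
      have h5 : t * g h ≤ c h := h4
      simp only [map_smul, smul_eq_mul]
      rw [mul_left_comm]
      exact mul_le_mul_of_nonneg_left h5 (by positivity))
  simp only [map_smul, smul_eq_mul] at hs
  have h6 : v h ≤ c h + ε * ‖h‖ := by
    have := mul_le_mul_of_nonneg_left hs hhn.le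
    rw [mul_add, mul_inv_cancel_left₀ hhn.ne', mul_inv_cancel_left₀ hhn.ne'] at this
    linarith
  linarith

/-- If the convexity defects tend to zero then the sequence eventually approaches slices which
contain `f`. -/
theorem eventually_exists_slice {C : Set (WeakDual ℝ X)} (hC : IsCompact C)
    (hconv : Convex ℝ C) (h0 : (0 : WeakDual ℝ X) ∈ C) {V : ι → Set (WeakDual ℝ X)} {t : ℝ}
    (ht : 0 < t) {f y : WeakDual ℝ X} (hy : y ∈ C) (hfy : f = t • y) {s : X × ℝ}
    (hs : s ∈ sliceFamily V C) (hsf : t * s.2 < f s.1) {v : ℕ → WeakDual ℝ X}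
    (hv1 : ∀ ε > 0, ∀ᶠ n in atTop, depthDefect (dilatedSliceFamily V C t) f (v n) < ε)
    (hv2 : ∀ ε > 0, ∀ᶠ n in atTop, depthDefect (disjointFamily C t) f (v n) < ε)
    {ε : ℝ} (hε : 0 < ε) :
    ∀ᶠ n in atTop, ∃ s' ∈ sliceFamily V C, t * s'.2 < f s'.1 ∧ ∃ b ∈ C, s'.2 < b s'.1 ∧
      ‖WeakDual.toStrongDual (v n - t • b)‖ ≤ ε := by
  have hF1 := isNormalizedFamily_dilatedSliceFamily V C ht.le
  have hF2 := isNormalizedFamily_disjointFamily C t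
  set c := f s.1 - t * s.2 with hc
  have hc0 : 0 < c := sub_pos.2 hsf
  have hcle : c ^ 2 ≤ supSqDepth (dilatedSliceFamily V C t) f := by
    refine le_trans (pow_le_pow_left₀ hc0.le ?_ 2) (hF1.sq_le_supSqDepth
      (Set.mem_insert_of_mem _ (Set.mem_image_of_mem _ hs)) f)
    exact le_max_left _ _
  have hzero : supSqDepth (disjointFamily C t) f = 0 := by
    refine le_antisymm (hF2.supSqDepth_le fun s hs => ?_) (hF2.supSqDepth_nonneg f)
    have h1 : f s.1 = t * y s.1 := by rw [hfy]; rfl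
    have h2 := hs.2.2 y hy
    have h3 : sliceDepth s f = 0 := max_eq_right (by rw [h1]; linarith)
    rw [h3]
    norm_num
  -- Defect `c ^ 2 / 64` gives one slice with depth above `c / 2` at `f` and at least `c / 4` at `v
  -- n`. Moving to `t • b` loses at most `c / 8`, so `b` stays in the slice.
  set ε' := min ε (c / 8) with hε'
  have hε'0 : 0 < ε' := lt_min hε (by positivity)
  filter_upwards [hv1 (c ^ 2 / 64) (by positivity), hv2 (ε' ^ 2 / 4) (by positivity)]
    with n hn1 hn2
  obtain ⟨s', hs', hA, hB⟩ := hF1.exists_of_depthDefect_lt hn1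
  have hf' : c / 2 < sliceDepth s' f := by
    refine lt_of_pow_lt_pow_left₀ 2 (sliceDepth_nonneg _ _) ?_
    nlinarith
  have hv' : c / 4 ≤ sliceDepth s' (v n) := by
    have h1 : |sliceDepth s' f - sliceDepth s' (v n)| < c / 4 := by
      refine abs_lt_of_sq_lt_sq ?_ (by positivity)
      linarith
    linarith [(abs_lt.1 h1).2]
  rcases hs' with rfl | ⟨s', hs', rfl⟩
  · simp [sliceDepth] at hf'
    linarith
  have hfs : c / 2 < f s'.1 - t * s'.2 := (lt_max_iff.1 hf').resolve_right (by linarith)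
  have hvs : c / 4 ≤ v n s'.1 - t * s'.2 := (le_max_iff.1 hv').resolve_right (by linarith)
  obtain ⟨b, hb, hbn⟩ := exists_norm_sub_le_of_disjointFamily hC hconv h0 (t := t) hε'0.le
    (v := v n) (fun r hr => by
      have h1 := (hF2.sq_le_supSqDepth hr (v n)).trans (hF2.supSqDepth_le_of_eq_zero hzero)
      have h2 : sliceDepth r (v n) ≤ ε' := by
        refine le_of_sq_le_sq ?_ hε'0.le
        linarith
      have h3 : v n r.1 - r.2 ≤ sliceDepth r (v n) := le_max_left _ _
      linarith)
  refine ⟨s', hs', by linarith, b, hb, ?_, hbn.trans (min_le_left _ _)⟩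
  have h1 : v n s'.1 - t * b s'.1 ≤ ε' := by
    have h2 : (WeakDual.toStrongDual (v n - t • b)) s'.1 = v n s'.1 - t * b s'.1 := rfl
    rw [← h2]
    refine (le_abs_self _).trans (((WeakDual.toStrongDual (v n - t • b)).le_opNorm s'.1).trans ?_)
    have h3 := hs'.1
    nlinarith [norm_nonneg (WeakDual.toStrongDual (v n - t • b)), norm_nonneg s'.1]
  have h4 : ε' ≤ c / 8 := min_le_right _ _
  exact lt_of_mul_lt_mul_left (by linarith) ht.le

/-- A weak* cluster point of a sequence approaching a weak* compact set in norm lies in it. -/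
theorem IsCompact.mem_of_mapClusterPt_of_norm {M : Set (WeakDual ℝ X)} (hM : IsCompact M)
    {z : ℕ → WeakDual ℝ X} {g : WeakDual ℝ X} (hg : MapClusterPt g atTop z)
    (hz : ∀ δ > 0, ∀ᶠ n in atTop, ∃ y ∈ M, ‖WeakDual.toStrongDual (z n - y)‖ ≤ δ) : g ∈ M := by
  have hnear : ∀ δ > 0, ∃ y ∈ M, ‖WeakDual.toStrongDual (g - y)‖ ≤ δ := fun δ hδ => by
    rw [← WeakDual.mem_add_closedBall_iff]
    by_contra hnot
    have h1 := (hM.isCompact_add_closedBall δ).isClosed.isOpen_compl.mem_nhds hnot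
    obtain ⟨n, hn1, hn2⟩ := ((hg.frequently h1).and_eventually (hz δ hδ)).exists
    exact hn1 (WeakDual.mem_add_closedBall_iff.2 hn2)
  choose y hyM hy using fun n : ℕ => hnear (1 / ((n : ℝ) + 1)) (by positivity)
  have hlim : Tendsto (fun n => WeakDual.toStrongDual (y n)) atTop
      (𝓝 (WeakDual.toStrongDual g)) := by
    rw [tendsto_iff_norm_sub_tendsto_zero]
    refine squeeze_zero (fun n => norm_nonneg _) (fun n => ?_)
      tendsto_one_div_add_atTop_nhds_zero_nat
    rw [norm_sub_rev, ← map_sub]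
    exact hy n
  exact hM.isClosed.mem_of_tendsto
    ((NormedSpace.Dual.toWeakDual_continuous.tendsto _).comp hlim) (Eventually.of_forall hyM)

end SliceLocalization

/-! ### Construction of the w*-LUR norm from a semimetrizable sphere. -/

section SemimetrizableSphere

variable {X : Type*} [NormedAddCommGroup X] [NormedSpace ℝ X] {q : Seminorm ℝ (StrongDual ℝ X)}

/-- Closed weak* neighbourhoods of the points of the sphere which are small for `ρ` on the sphere
and close to the sphere. -/
theorem IsEquivalentDualNorm.exists_closed_nhds (hq : IsEquivalentDualNorm q)
    {ρ : weakStarUnitSphere q → weakStarUnitSphere q → ℝ}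
    (hbasis : ∀ x, (𝓝 x).HasBasis (fun ε : ℝ => 0 < ε) (fun ε => {y | ρ x y < ε}))
    {ε : ℝ} (hε : 0 < ε) (x : weakStarUnitSphere q) :
    ∃ K : Set (WeakDual ℝ X), IsClosed K ∧ x.1 ∈ interior K ∧
      (∀ y : weakStarUnitSphere q, y.1 ∈ K → ρ x y < ε) ∧
      ∀ g ∈ K, 1 - ε < q (WeakDual.toStrongDual g) := by
  have h1 := (hbasis x).mem_of_mem hε
  rw [nhds_subtype_eq_comap, mem_comap] at h1
  obtain ⟨t, ht, hts⟩ := h1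
  have hx : q (WeakDual.toStrongDual x.1) = 1 := x.2
  have h2 : {g : WeakDual ℝ X | q (WeakDual.toStrongDual g) ≤ 1 - ε}ᶜ ∈ 𝓝 x.1 :=
    (hq.isClosed_sublevel _).isOpen_compl.mem_nhds
      (not_le.2 (show 1 - ε < q (WeakDual.toStrongDual x.1) by linarith))
  obtain ⟨K, hK, hKc, hKsub⟩ := exists_mem_nhds_isClosed_subset (inter_mem ht h2)
  exact ⟨K, hKc, mem_interior_iff_mem_nhds.2 hK, fun y hy => hts (hKsub hy).1,
    fun g hg => not_le.1 (hKsub hg).2⟩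

theorem IsEquivalentDualNorm.exists_isWeakStarLUR (hq : IsEquivalentDualNorm q)
    (hS : IsSemimetrizable (weakStarUnitSphere q)) :
    ∃ N : Seminorm ℝ (StrongDual ℝ X), IsEquivalentDualNorm N ∧ IsWeakStarLUR N := by
  obtain ⟨ρ, hρ, hbasis⟩ := hS
  have hm0 : ∀ m : ℕ, (0 : ℝ) < 1 / ((m : ℝ) + 1) := fun m => by positivity
  choose K hKc hKint hKρ hKq using fun m : ℕ => hq.exists_closed_nhds hbasis (hm0 m)
  choose V hVo hVU hVcov hVuniq using fun m => hρ.exists_refinements hbasis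
    (fun x => interior (K m x)) (fun x => isOpen_interior) (hKint m)
  -- On `K m x` the norm is strictly above `1 - 1/(m+1) ≥ 0`, even for `m = 0`.
  have hV0 : ∀ m n x, (0 : WeakDual ℝ X) ∉ V m n x := fun m n x hmem => by
    have h1 := hKq m x 0 (interior_subset (hVU m n x hmem))
    rw [map_zero, map_zero, sub_neg, lt_div_iff₀ (by positivity)] at h1
    linarith [(Nat.cast_nonneg m : (0 : ℝ) ≤ m)]
  set B : Set (WeakDual ℝ X) := {f | q (WeakDual.toStrongDual f) ≤ 1} with hB
  have hBc : IsCompact B := hq.isCompact_sublevel 1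
  have hspec := fun m n => iterate_sliceDerivative_spec hBc (q.convex_sublevel_toStrongDual 1)
    (show (0 : WeakDual ℝ X) ∈ B by simp [hB]) (V m n)
  obtain ⟨a, A, ha, -, hqa⟩ := id hq.1
  have hBnorm : ∀ b ∈ B, ‖WeakDual.toStrongDual b‖ ≤ 1 / a := fun b hb => by
    rw [le_div_iff₀ ha]
    linarith [(hqa (WeakDual.toStrongDual b)).1, show q (WeakDual.toStrongDual b) ≤ 1 from hb]
  -- Rational dilations keep the index set countable; they approximate the unknown value `q f`.
  let F : (ℕ × ℕ × ℕ × {t : ℚ // 0 < t}) × Bool → Set (X × ℝ) := fun i =>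
    bif i.2 then
      dilatedSliceFamily (V i.1.1 i.1.2.1) ((sliceDerivative (V i.1.1 i.1.2.1))^[i.1.2.2.1] B)
        (i.1.2.2.2.1 : ℝ)
    else
      disjointFamily ((sliceDerivative (V i.1.1 i.1.2.1))^[i.1.2.2.1] B) (i.1.2.2.2.1 : ℝ)
  have hF : ∀ i, IsNormalizedFamily (F i) := by
    rintro ⟨⟨m, n, j, t, ht⟩, b⟩
    cases b
    · exact isNormalizedFamily_disjointFamily _ _
    · exact isNormalizedFamily_dilatedSliceFamily _ _ (by exact_mod_cast ht.le)
  obtain ⟨N, hN, hNdef⟩ := exists_dualNorm_of_families hF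
  refine ⟨N, hN, isWeakStarLUR_of_sphere hN.1 fun f v hf hv hlim => ?_⟩
  have hdef := hNdef f v hf hv hlim
  set r := q f with hr
  have hf0 : f ≠ 0 := by rintro rfl; simp at hf
  have hr0 : 0 < r := (apply_nonneg q f).lt_of_ne fun h => hf0 (hq.1.eq_zero_of_map_eq_zero h.symm)
  set f' : WeakDual ℝ X := StrongDual.toWeakDual f with hf'
  set F' : WeakDual ℝ X := r⁻¹ • f' with hF'
  have hfF' : f' = r • F' := (smul_inv_smul₀ hr0.ne' f').symm
  have hF'S : F' ∈ weakStarUnitSphere q := by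
    change q (WeakDual.toStrongDual (r⁻¹ • f')) = 1
    rw [map_smul, map_smul_eq_mul, Real.norm_of_nonneg (by positivity), hf',
      StrongDual.toStrongDual_toWeakDual, ← hr, inv_mul_cancel₀ hr0.ne']
  have hmain : ∀ m, ∃ x, F' ∈ K m x ∧ ∀ δ > 0, ∀ᶠ n in atTop, ∃ y ∈ K m x ∩ B,
      ‖WeakDual.toStrongDual (r⁻¹ • StrongDual.toWeakDual (v n) - y)‖ ≤ δ := fun m => by
    obtain ⟨n₀, x, hx⟩ := hVuniq m F' hF'S
    have hxV : F' ∈ V m n₀ x := by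
      obtain ⟨x', hx'⟩ := hVcov m n₀ F' hF'S
      rwa [← hx x' hx']
    refine ⟨x, interior_subset (hVU m n₀ x hxV), fun δ hδ => ?_⟩
    obtain ⟨j, s, hFj, hs, hsF⟩ := hq.exists_slice_iterate (hVo m n₀) (hVcov m n₀) (hV0 m n₀) hB
      hF'S
    set C := (sliceDerivative (V m n₀))^[j] B with hC
    obtain ⟨hCc, hCconv, hC0, hCB⟩ := hspec m n₀ j
    -- A rational `t` slightly above `r` keeps `f'` in the dilated slice and, by star-shapedness, in
    -- `t • C`. Replacing `r` by `t` costs less than `δ / 2` on `B`.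
    have hev : ∀ᶠ t in 𝓝 r, t * s.2 < f' s.1 ∧ |r⁻¹ * t - 1| * (1 / a) < δ / 2 := by
      refine Eventually.and ?_ ?_
      · refine (continuous_id.mul continuous_const).continuousAt.eventually_lt_const ?_
        rw [hfF']
        exact mul_lt_mul_of_pos_left hsF hr0
      · refine (by fun_prop : Continuous fun t : ℝ =>
          |r⁻¹ * t - 1| * (1 / a)).continuousAt.eventually_lt_const ?_
        simp only [inv_mul_cancel₀ hr0.ne', sub_self, abs_zero, zero_mul]
        positivity
    obtain ⟨κ, hκ, hball⟩ := Metric.eventually_nhds_iff.1 hev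
    obtain ⟨t, hrt, htκ⟩ := exists_rat_btwn (lt_add_of_pos_right r hκ)
    have ht0 : (0 : ℝ) < t := hr0.trans hrt
    obtain ⟨hts, htδ⟩ := hball (y := (t : ℝ)) (by
      rw [Real.dist_eq, abs_of_pos (sub_pos.2 hrt)]; linarith)
    have hy : ((t : ℝ)⁻¹ * r) • F' ∈ C :=
      hCconv.smul_mem_of_zero_mem hC0 hFj
        ⟨by positivity, by rw [inv_mul_le_iff₀ ht0]; linarith⟩
    have hfy : f' = (t : ℝ) • ((t : ℝ)⁻¹ * r) • F' := by
      rw [smul_smul, mul_inv_cancel_left₀ ht0.ne', ← hfF']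
    have ht0' : (0 : ℚ) < t := by exact_mod_cast ht0
    have hsl := eventually_exists_slice hCc hCconv hC0 ht0 hy hfy hs hts
      (v := fun n => StrongDual.toWeakDual (v n))
      (hdef ((m, n₀, j, ⟨t, ht0'⟩), true)) (hdef ((m, n₀, j, ⟨t, ht0'⟩), false))
      (ε := r * (δ / 2)) (by positivity)
    filter_upwards [hsl] with n hn
    obtain ⟨s', hs', hs'f, b, hb, hs'b, hvb⟩ := hn
    obtain ⟨-, hs'0, x', hx'⟩ := hs'
    have hF's : s'.2 < F' s'.1 := by
      have h1 : f' s'.1 = r * F' s'.1 := by rw [hfF']; rfl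
      rw [h1] at hs'f
      have h2 : r * s'.2 ≤ t * s'.2 := mul_le_mul_of_nonneg_right hrt.le hs'0
      exact lt_of_mul_lt_mul_left (h2.trans_lt hs'f) hr0.le
    -- The slice contains `F'` and lies in one member of `V m n₀`; uniqueness identifies that
    -- member.
    have hxx : x' = x := hx x' (hx' F' hFj hF's)
    have hbV : b ∈ V m n₀ x := hxx ▸ hx' b hb hs'b
    refine ⟨b, ⟨interior_subset (hVU m n₀ x hbV), hCB hb⟩, ?_⟩
    have hsplit : r⁻¹ • StrongDual.toWeakDual (v n) - b =
        r⁻¹ • (StrongDual.toWeakDual (v n) - (t : ℝ) • b) + (r⁻¹ * t - 1) • b := by module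
    rw [hsplit, map_add, map_smul, map_smul]
    refine (norm_add_le _ _).trans ?_
    rw [norm_smul, norm_smul, Real.norm_of_nonneg (inv_nonneg.2 hr0.le), Real.norm_eq_abs]
    have h1 : r⁻¹ * ‖WeakDual.toStrongDual (StrongDual.toWeakDual (v n) - (t : ℝ) • b)‖ ≤ δ / 2 := by
      rw [inv_mul_le_iff₀ hr0]
      exact hvb
    have h2 := mul_le_mul_of_nonneg_left (hBnorm b (hCB hb)) (abs_nonneg (r⁻¹ * t - 1))
    linarith
  choose x hxF hxlim using hmain
  have hclim : Tendsto (fun n => r⁻¹ • StrongDual.toWeakDual (v n)) atTop (𝓝 F') := by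
    refine (hN.isCompact_sublevel r⁻¹).tendsto_nhds_of_unique_mapClusterPt
      (Eventually.of_forall fun n => ?_) fun g _ hg => ?_
    · change N (WeakDual.toStrongDual (r⁻¹ • StrongDual.toWeakDual (v n))) ≤ r⁻¹
      rw [map_smul, map_smul_eq_mul, Real.norm_of_nonneg (inv_nonneg.2 hr0.le),
        StrongDual.toStrongDual_toWeakDual, hv, mul_one]
    · have hgK : ∀ m, g ∈ K m (x m) ∩ B := fun m =>
        (hBc.inter_left (hKc m (x m))).mem_of_mapClusterPt_of_norm hg (hxlim m)
      have hgS : g ∈ weakStarUnitSphere q := by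
        refine le_antisymm (hgK 0).2 (le_of_forall_pos_lt_add fun ε hε => ?_)
        obtain ⟨m, hm⟩ := exists_nat_one_div_lt hε
        linarith [hKq m (x m) g (hgK m).1]
      -- No triangle inequality is available: instead, the centres `x m` converge to both `g` and
      -- `F'` in a Hausdorff space.
      have hto : ∀ (e : weakStarUnitSphere q), (∀ m, e.1 ∈ K m (x m)) →
          Tendsto x atTop (𝓝 e) := fun e he => by
        refine (hbasis e).tendsto_right_iff.2 fun ε hε => ?_
        have h1 : ∀ᶠ m : ℕ in atTop, 1 / ((m : ℝ) + 1) < ε :=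
          tendsto_one_div_add_atTop_nhds_zero_nat.eventually_lt_const hε
        filter_upwards [h1] with m hm
        rw [hρ.symm]
        exact (hKρ m (x m) e (he m)).trans hm
      exact congrArg Subtype.val (tendsto_nhds_unique
        (hto ⟨g, hgS⟩ fun m => (hgK m).1) (hto ⟨F', hF'S⟩ hxF))
  have := hclim.const_smul r
  simpa only [smul_inv_smul₀ hr0.ne', ← hfF'] using this

end SemimetrizableSphere

theorem mainTheorem5 (X : Type*) [NormedAddCommGroup X] [NormedSpace ℝ X] :
    (∃ q : Seminorm ℝ (StrongDual ℝ X), IsEquivalentDualNorm q ∧ IsWeakStarLUR q) ↔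
      ∃ q : Seminorm ℝ (StrongDual ℝ X), IsEquivalentDualNorm q ∧
        IsSemimetrizable (weakStarUnitSphere q) :=
  ⟨fun ⟨q, hq, hlur⟩ => ⟨q, hq, hlur.isSemimetrizable hq⟩,
    fun ⟨_, hq, hS⟩ => hq.exists_isWeakStarLUR hS⟩
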